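/- Let $\mathbb{F}_q$ be a finite field of characteristic different from $2$ and $3$, and let $E$ be the elliptic curve $y^2=f(x)$, $f(x)=x^3+Ax+B$, where $A,B\in\mathbb{F}_q$ and $f$ has no multiple roots. Let $\varphi$ be the Frobenius endomorphism $(x,y)\mapsto(x^q,y^q)$ of $E(\mathbb{F}_{q^3})$ and let $T_3=\{P\in E(\mathbb{F}_{q^3}) : P+\varphi(P)+\varphi^2(P)=P_\infty\}$. For $P\in T_3\setminus\{P_\infty\}$ let $h_P=y-(\alpha_1x+\alpha_0)$, with $\alpha_1,\alpha_0\in\mathbb{F}_q$, be the equation of the line through $P,\varphi(P),\varphi^2(P)$ (counted with multiplicity, i.e. $\mathrm{div}(h_P)=P+\varphi(P)+\varphi^2(P)-3P_\infty$). Note that $h_{-P}(x,y)=-h_P(x,-y)$. Define the following polynomials in $\alpha_1,\alpha_0,A,B$. Doubling formulas, $h_{2P}=cy-(u_0+u_1x)$: $u_1 = 4B\alpha_1^4 - 4A\alpha_1^3\alpha_0 + 4A^2\alpha_1^2 - 4\alpha_1\alpha_0^3 + 36B\alpha_1\alpha_0 - 12A\alpha_0^2$, $u_0 = -A^2\alpha_1^4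 - 8B\alpha_1^3\alpha_0 + 2A\alpha_1^2\alpha_0^2 + 6AB\alpha_1^2 - 8A^2\alpha_1\alpha_0 - \alpha_0^4 - 18B\alpha_0^2 + 4A^3 + 27B^2$, $c = 8B\alpha_1^3 - 8A\alpha_1^2\alpha_0 - 8\alpha_0^3$. Tripling formulas, $h_{3P}=dy-(v_0+v_1x)$: $v_1 = \tfrac{1}{3}A^4\alpha_1^9 + 8A^2B\alpha_1^8\alpha_0 + (-4A^3 + 48B^2)\alpha_1^7\alpha_0^2 + (16A^3B + 144B^3)\alpha_1^7 - 48AB\alpha_1^6\alpha_0^3 + (-16A^4 - 240AB^2)\alpha_1^6\alpha_0 + 10A^2\alpha_1^5\alpha_0^4 + 192A^2B\alpha_1^5\alpha_0^2 + (8A^5 + 54A^2B^2)\alpha_1^5 - 24B\alpha_1^4\alpha_0^5 + (-112A^3 + 144B^2)\alpha_1^4\alpha_0^3 + (96A^3B + 648B^3)\alpha_1^4\alpha_0 + 12A\alpha_1^3\alpha_0^6 - 240AB\alpha_1^3\alpha_0^4 + (-48A^4 - 324AB^2)\alpha_1^3\alpha_0^2 + (-32A^4B - 216AB^3)\alpha_1^3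 - 48A^2\alpha_1^2\alpha_0^5 + (64A^5 + 432A^2B^2)\alpha_1^2\alpha_0 + 3\alpha_1\alpha_0^8 - 288B\alpha_1\alpha_0^6 + (-24A^3 - 162B^2)\alpha_1\alpha_0^4 + (288A^3B + 1944B^3)\alpha_1\alpha_0^2 + (-16A^6 - 216A^3B^2 - 729B^4)\alpha_1 + 48A\alpha_0^7 + (-64A^4 - 432AB^2)\alpha_0^3$, $v_0 = (-\tfrac{8}{3}A^3B - \tfrac{64}{3}B^3)\alpha_1^9 + (3A^4 + 32AB^2)\alpha_1^8\alpha_0 - 16A^2B\alpha_1^7\alpha_0^2 - 8A^2B^2\alpha_1^7 + (12A^3 + 16B^2)\alpha_1^6\alpha_0^3 + (8A^3B - 144B^3)\alpha_1^6\alpha_0 + 8AB\alpha_1^5\alpha_0^4 + 288AB^2\alpha_1^5\alpha_0^2 + (32A^4B + 216AB^3)\alpha_1^5 + 10A^2\alpha_1^4\alpha_0^5 - 200A^2B\alpha_1^4\alpha_0^3 + (-24A^5 - 162A^2B^2)\alpha_1^4\alpha_0 + 32B\alpha_1^3\alpha_0^6 + (64A^3 + 72B^2)\alpha_1^3\alpha_0^4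 + (192A^3B + 1296B^3)\alpha_1^3\alpha_0^2 + (96A^3B^2 + 648B^4)\alpha_1^3 - 4A\alpha_1^2\alpha_0^7 - 72AB\alpha_1^2\alpha_0^5 + (-176A^4 - 1188AB^2)\alpha_1^2\alpha_0^3 + (-192A^4B - 1296AB^3)\alpha_1^2\alpha_0 + 64A^2\alpha_1\alpha_0^6 + (128A^5 + 864A^2B^2)\alpha_1\alpha_0^2 + \tfrac{1}{3}\alpha_0^9 + 72B\alpha_0^7 + (-120A^3 - 810B^2)\alpha_0^5 + (192A^3B + 1296B^3)\alpha_0^3 + (-16A^6 - 216A^3B^2 - 729B^4)\alpha_0$, $d = A^4\alpha_1^8 + 24A^2B\alpha_1^7\alpha_0 + (-12A^3 + 144B^2)\alpha_1^6\alpha_0^2 + (-24A^3B - 144B^3)\alpha_1^6 - 144AB\alpha_1^5\alpha_0^3 + (32A^4 + 144AB^2)\alpha_1^5\alpha_0 + 30A^2\alpha_1^4\alpha_0^4 + 120A^2B\alpha_1^4\alpha_0^2 + (-8A^5 - 54A^2B^2)\alpha_1^4 - 72B\alpha_1^3\alpha_0^5 + 720B^2\alpha_1^3\alpha_0^3 +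 (-96A^3B - 648B^3)\alpha_1^3\alpha_0 + 36A\alpha_1^2\alpha_0^6 - 360AB\alpha_1^2\alpha_0^4 + (48A^4 + 324AB^2)\alpha_1^2\alpha_0^2 + 96A^2\alpha_1\alpha_0^5 + 9\alpha_0^8 + 72B\alpha_0^6 + (24A^3 + 162B^2)\alpha_0^4 - \tfrac{16}{3}A^6 - 72A^3B^2 - 243B^4$. Procedure 2, run on $y-(\alpha_1x+\alpha_0)$ with $\alpha_1,\alpha_0$ in a field $k\supseteq\mathbb{F}_q$, is the following computation, with variables $x_{P_i},y_{P_i}$ ($i=1,2,3$). 1. Put $x_{2P_i}=\left(\frac{f'(x_{P_i})}{2y_{P_i}}\right)^2-2x_{P_i}$, $y_{2P_i}=\frac{f'(x_{P_i})}{2y_{P_i}}(x_{P_i}-x_{2P_i})-y_{P_i}$ and $\ell_i=(y_{2P_i}-y_{P_i})x+(x_{P_i}-x_{2P_i})y+\left((x_{2P_i}-x_{P_i})y_{P_i}+(y_{P_i}-y_{2P_i})x_{P_i}\right)$ (the line through $P_i$ and $2P_i$), and $L=\ell_1\ell_2\ell_3$. 2. Replace each $y_{P_i}$ in $L$ by $\alpha_1x_{P_i}+\alpha_0$,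 and write $L$ as a polynomial in $x,y$ whose coefficients are rational functions, over $k$, of the elementary symmetric polynomials $e_1,e_2,e_3$ of $x_{P_1},x_{P_2},x_{P_3}$. 3. Replace $e_1,e_2,e_3$ by $E_1=\alpha_1^2$, $E_2=A-2\alpha_0\alpha_1$, $E_3=\alpha_0^2-B$ in $L$. This gives $L(x,y)\in k[x,y]$. 4. Return $\dfrac{L(x,-y)}{h_{-P}\,h_{-2P}} \bmod y^2-f(x)$, computed in the field of fractions of $k[x,y]/(y^2-f(x))$, where $h_{-P}=y+(\alpha_1x+\alpha_0)$ and $h_{-2P}=cy+(u_0+u_1x)$. **Theorem.** Procedure 2 is correct. Precisely: (a) For every field $k\supseteq\mathbb{F}_q$ and all $\alpha_1,\alpha_0\in k$ with $c\neq0$ (in particular for $k=\mathbb{F}_q(\alpha_1,\alpha_0)$ with $\alpha_1,\alpha_0$ indeterminates) steps 2 and 3 can be carried out (with denominators that do not vanish under the substitution), their result $L(x,y)$ is unique, and step 4 returns, up to multiplication by a nonzero constant of $k$, the class of $dy-(v_0+v_1x)$. (b) For every $P\in T_3\setminus\{P_\infty\}$ the line $h_P=y-(\alpha_1x+\alpha_0)$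 exists and is unique. If $3P\neq P_\infty$, then $d\ne0$ and $h_{3P}=dy-(v_0+v_1x)$ up to multiplication by a nonzero constant, that is, $h_{3P}=y-\left(\frac{v_1}{d}x+\frac{v_0}{d}\right)$. If moreover $2P\neq P_\infty$, then $c\neq0$, so that Procedure 2 can be run on $h_P$, and it returns the class of $h_{3P}$ up to multiplication by a nonzero constant of $\mathbb{F}_q$. -/

import Mathlib

open Polynomial
open scoped Polynomial.Bivariate

universe u v

noncomputable section

namespace TraceZero

/-! ## The curve, the trace-zero subgroup and the line through the Frobenius conjugates -/

/-- The short Weierstrass curve `y² = x³ + A x + B`. -/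
def curve {k : Type*} [CommRing k] (A B : k) : WeierstrassCurve.Affine k :=
  { a₁ := 0, a₂ := 0, a₃ := 0, a₄ := A, a₆ := B }

/-- The cubic `f = x³ + A x + B`. -/
def cubic {k : Type*} [CommRing k] (A B : k) : k[X] :=
  X ^ 3 + C A * X + C B

section Points

variable {F : Type*} [Field F] (K : Type*) [Field K] [Algebra F K]

/-- The group `E(K)` for a field extension `K` of the field of definition of `E`. -/
abbrev Points (A B : F) : Type _ :=
  (WeierstrassCurve.Affine.baseChange (curve A B) K).Point

variable [Fintype F] [DecidableEq K]

/-- The Frobenius endomorphism `(x, y) ↦ (x ^ q, y ^ q)` of `E(K)`, where `q = |F|`. -/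
def frob (A B : F) : Points K A B →+ Points K A B :=
  WeierstrassCurve.Affine.Point.map (W' := curve A B) (FiniteField.frobeniusAlgHom F K)

/-- The degree three trace-zero subgroup: all `P` with `P + φ(P) + φ²(P) = 0`. -/
def T₃ (A B : F) : AddSubgroup (Points K A B) :=
  (AddMonoidHom.id _ + frob K A B + (frob K A B).comp (frob K A B)).ker

variable {K}

/-- `IsConjLine P α₁ α₀` says that `y - (α₁ x + α₀)` is the equation `h_P` of the line through
`P`, `φ(P)` and `φ²(P)`: these are affine points `(x i, y i)` on the line, and they are, counted
with multiplicity, all the intersection points of the line with the curve (substituting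
`y = α₁ x + α₀` in `f - y²` leaves the product of the `X - x i`). In other words the divisor of
`y - (α₁ x + α₀)` on `E` is `P + φ(P) + φ²(P) - 3 P_∞`. -/
def IsConjLine {A B : F} (P : Points K A B) (α₁ α₀ : F) : Prop :=
  ∃ (x y : Fin 3 → K)
    (h : ∀ i, (WeierstrassCurve.Affine.baseChange (curve A B) K).Nonsingular (x i) (y i)),
    (∀ i : Fin 3, (frob K A B)^[(i : ℕ)] P = .some (x i) (y i) (h i)) ∧
    (∀ i, y i = algebraMap F K α₁ * x i + algebraMap F K α₀) ∧
    (cubic A B - (C α₁ * X + C α₀) ^ 2).map (algebraMap F K) = ∏ i, (X - C (x i))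

end Points

/-! ## The explicit doubling and tripling formulas -/

section Formulas

variable {k : Type*} [Field k]

/-- Doubling formulas `h_{2P} = c y - (u₀ + u₁ x)`: the coefficient `u₁`. -/
def u₁ (A B α₁ α₀ : k) : k :=
  4 * B * α₁^4 - 4 * A * α₁^3 * α₀ + 4 * A^2 * α₁^2 - 4 * α₁ * α₀^3 + 36 * B * α₁ * α₀ - 12 * A
    * α₀^2

/-- Doubling formulas `h_{2P} = c y - (u₀ + u₁ x)`: the coefficient `u₀`. -/
def u₀ (A B α₁ α₀ : k) : k :=
  -A^2 * α₁^4 - 8 * B * α₁^3 * α₀ + 2 * A * α₁^2 * α₀^2 + 6 * A * B * α₁^2 - 8 * A^2 * α₁ * α₀ -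
    α₀^4 - 18 * B * α₀^2 + 4 * A^3 + 27 * B^2

/-- Doubling formulas `h_{2P} = c y - (u₀ + u₁ x)`: the coefficient `c`. -/
def c (A B α₁ α₀ : k) : k :=
  8 * B * α₁^3 - 8 * A * α₁^2 * α₀ - 8 * α₀^3

/-- Tripling formulas `h_{3P} = d y - (v₀ + v₁ x)`: the coefficient `v₁`. -/
def v₁ (A B α₁ α₀ : k) : k :=
  1/3 * A^4 * α₁^9 + 8 * A^2 * B * α₁^8 * α₀ + (-4 * A^3 + 48 * B^2) * α₁^7 * α₀^2 + (16 * A^3 *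
    B + 144 * B^3) * α₁^7 - 48 * A * B * α₁^6 * α₀^3 + (-16 * A^4 - 240 * A * B^2) * α₁^6 * α₀ +
    10 * A^2 * α₁^5 * α₀^4 + 192 * A^2 * B * α₁^5 * α₀^2 + (8 * A^5 + 54 * A^2 * B^2) * α₁^5 -
    24 * B * α₁^4 * α₀^5 + (-112 * A^3 + 144 * B^2) * α₁^4 * α₀^3 + (96 * A^3 * B + 648 * B^3) *
    α₁^4 * α₀ + 12 * A * α₁^3 * α₀^6 - 240 * A * B * α₁^3 * α₀^4 + (-48 * A^4 - 324 * A * B^2) *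
    α₁^3 * α₀^2 + (-32 * A^4 * B - 216 * A * B^3) * α₁^3 - 48 * A^2 * α₁^2 * α₀^5 + (64 * A^5 +
    432 * A^2 * B^2) * α₁^2 * α₀ + 3 * α₁ * α₀^8 - 288 * B * α₁ * α₀^6 + (-24 * A^3 - 162 * B^2)
    * α₁ * α₀^4 + (288 * A^3 * B + 1944 * B^3) * α₁ * α₀^2 + (-16 * A^6 - 216 * A^3 * B^2 - 729
    * B^4) * α₁ + 48 * A * α₀^7 + (-64 * A^4 - 432 * A * B^2) * α₀^3

/-- Tripling formulas `h_{3P} = d y - (v₀ + v₁ x)`: the coefficient `v₀`. -/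
def v₀ (A B α₁ α₀ : k) : k :=
  (-8/3 * A^3 * B - 64/3 * B^3) * α₁^9 + (3 * A^4 + 32 * A * B^2) * α₁^8 * α₀ - 16 * A^2 * B *
    α₁^7 * α₀^2 - 8 * A^2 * B^2 * α₁^7 + (12 * A^3 + 16 * B^2) * α₁^6 * α₀^3 + (8 * A^3 * B -
    144 * B^3) * α₁^6 * α₀ + 8 * A * B * α₁^5 * α₀^4 + 288 * A * B^2 * α₁^5 * α₀^2 + (32 * A^4 *
    B + 216 * A * B^3) * α₁^5 + 10 * A^2 * α₁^4 * α₀^5 - 200 * A^2 * B * α₁^4 * α₀^3 + (-24 *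
    A^5 - 162 * A^2 * B^2) * α₁^4 * α₀ + 32 * B * α₁^3 * α₀^6 + (64 * A^3 + 72 * B^2) * α₁^3 *
    α₀^4 + (192 * A^3 * B + 1296 * B^3) * α₁^3 * α₀^2 + (96 * A^3 * B^2 + 648 * B^4) * α₁^3 - 4
    * A * α₁^2 * α₀^7 - 72 * A * B * α₁^2 * α₀^5 + (-176 * A^4 - 1188 * A * B^2) * α₁^2 * α₀^3 +
    (-192 * A^4 * B - 1296 * A * B^3) * α₁^2 * α₀ + 64 * A^2 * α₁ * α₀^6 + (128 * A^5 + 864 *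
    A^2 * B^2) * α₁ * α₀^2 + 1/3 * α₀^9 + 72 * B * α₀^7 + (-120 * A^3 - 810 * B^2) * α₀^5 + (192
    * A^3 * B + 1296 * B^3) * α₀^3 + (-16 * A^6 - 216 * A^3 * B^2 - 729 * B^4) * α₀

/-- Tripling formulas `h_{3P} = d y - (v₀ + v₁ x)`: the coefficient `d`. -/
def d (A B α₁ α₀ : k) : k :=
  A^4 * α₁^8 + 24 * A^2 * B * α₁^7 * α₀ + (-12 * A^3 + 144 * B^2) * α₁^6 * α₀^2 + (-24 * A^3 * B
    - 144 * B^3) * α₁^6 - 144 * A * B * α₁^5 * α₀^3 + (32 * A^4 + 144 * A * B^2) * α₁^5 * α₀ +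
    30 * A^2 * α₁^4 * α₀^4 + 120 * A^2 * B * α₁^4 * α₀^2 + (-8 * A^5 - 54 * A^2 * B^2) * α₁^4 -
    72 * B * α₁^3 * α₀^5 + 720 * B^2 * α₁^3 * α₀^3 + (-96 * A^3 * B - 648 * B^3) * α₁^3 * α₀ +
    36 * A * α₁^2 * α₀^6 - 360 * A * B * α₁^2 * α₀^4 + (48 * A^4 + 324 * A * B^2) * α₁^2 * α₀^2
    + 96 * A^2 * α₁ * α₀^5 + 9 * α₀^8 + 72 * B * α₀^6 + (24 * A^3 + 162 * B^2) * α₀^4 - 16/3 *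
    A^6 - 72 * A^3 * B^2 - 243 * B^4

/-- The polynomial `γ y - (β₁ x + β₀)` in `k[x, y]`; here `C X` is `x` and `Y` is `y`. -/
def linePoly (γ β₁ β₀ : k) : k[X][Y] :=
  C (C γ) * Y - C (C β₁ * X + C β₀)

/-- The substitution `g(x, y) ↦ g(x, -y)`. -/
def flipY (g : k[X][Y]) : k[X][Y] := g.comp (-Polynomial.X)

end Formulas

/-! ## Procedure 2 -/

section Procedure

/-- The `x`-coordinate of `2P` as a rational expression in the coordinates of `P = (x, y)`. -/
def dblX {M : Type*} [Field M] (A x y : M) : M :=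
  ((3 * x ^ 2 + A) / (2 * y)) ^ 2 - 2 * x

/-- The `y`-coordinate of `2P` as a rational expression in the coordinates of `P = (x, y)`. -/
def dblY {M : Type*} [Field M] (A x y : M) : M :=
  (3 * x ^ 2 + A) / (2 * y) * (x - dblX A x y) - y

/-- The line `ℓ` through `P = (x₁, y₁)` and `2P = (x₂, y₂)`:
`(y₂ - y₁) x + (x₁ - x₂) y + ((x₂ - x₁) y₁ + (y₁ - y₂) x₁)`. -/
def ell {M : Type*} [Field M] (A x₁ y₁ : M) : M[X][Y] :=
  let x₂ := dblX A x₁ y₁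
  let y₂ := dblY A x₁ y₁
  C (C (y₂ - y₁) * X) + C (C (x₁ - x₂)) * Y + C (C ((x₂ - x₁) * y₁ + (y₁ - y₂) * x₁))

variable {k : Type*} [Field k]

/-- Rational functions over `k` in the three variables `x_{P₁}, x_{P₂}, x_{P₃}`. -/
abbrev RatFun₃ (k : Type*) [Field k] : Type _ := FractionRing (MvPolynomial (Fin 3) k)

/-- The product `L = ℓ₁ ℓ₂ ℓ₃`, after replacing `y_{Pᵢ}` by `α₁ x_{Pᵢ} + α₀`. It is a polynomial
in `x, y` whose coefficients are rational functions of `x_{P₁}, x_{P₂}, x_{P₃}`. -/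
def prodL (A α₁ α₀ : k) : (RatFun₃ k)[X][Y] :=
  ∏ i : Fin 3,
    ell (algebraMap k (RatFun₃ k) A)
      (algebraMap (MvPolynomial (Fin 3) k) (RatFun₃ k) (MvPolynomial.X i))
      (algebraMap (MvPolynomial (Fin 3) k) (RatFun₃ k)
        (MvPolynomial.C α₁ * MvPolynomial.X i + MvPolynomial.C α₀))

/-- A polynomial `N(e₁, e₂, e₃)` read as a function of `x_{P₁}, x_{P₂}, x_{P₃}`, where `eᵢ` is the
`i`-th elementary symmetric polynomial in these variables. -/
def inEsymm : MvPolynomial (Fin 3) k →+* RatFun₃ k :=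
  (algebraMap (MvPolynomial (Fin 3) k) (RatFun₃ k)).comp
    (MvPolynomial.aeval fun i : Fin 3 => MvPolynomial.esymm (Fin 3) k (i + 1)).toRingHom

/-- `IsSymmSubst E L L'`: one can write `L = N(e₁, e₂, e₃) / D(e₁, e₂, e₃)`, with `N` a polynomial
in `x, y` whose coefficients are polynomials in `e₁, e₂, e₃`, and with `D(E₁, E₂, E₃) ≠ 0`, and
replacing `eᵢ` by `Eᵢ` in this expression gives `L'`. -/
def IsSymmSubst (E : Fin 3 → k) (L : (RatFun₃ k)[X][Y]) (L' : k[X][Y]) : Prop :=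
  ∃ (N : (MvPolynomial (Fin 3) k)[X][Y]) (D : MvPolynomial (Fin 3) k),
    MvPolynomial.eval E D ≠ 0 ∧
    L = C (C (inEsymm D)⁻¹) * N.map (mapRingHom inEsymm) ∧
    L' = C (C (MvPolynomial.eval E D)⁻¹) * N.map (mapRingHom (MvPolynomial.eval E))

/-- `IsProcL A B α₁ α₀ L'`: the polynomial `L' ∈ k[x, y]` is obtained from `h_P = y - (α₁ x + α₀)`
by the steps of the procedure that precede the division: form the product of the lines through
`Pᵢ` and `2Pᵢ`, replace `y_{Pᵢ}` by `α₁ x_{Pᵢ} + α₀`, write the result in `e₁, e₂, e₃`, and replace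
`e₁, e₂, e₃` by `E₁ = α₁²`, `E₂ = A - 2 α₀ α₁`, `E₃ = α₀² - B`. -/
def IsProcL (A B α₁ α₀ : k) (L' : k[X][Y]) : Prop :=
  IsSymmSubst ![α₁ ^ 2, A - 2 * α₀ * α₁, α₀ ^ 2 - B] (prodL A α₁ α₀) L'

/-- The class of a polynomial in `x, y` modulo `y² - f(x)`, in the function field of `E`. -/
def toFun (A B : k) (g : k[X][Y]) : (curve A B).FunctionField :=
  algebraMap (curve A B).CoordinateRing (curve A B).FunctionField
    (WeierstrassCurve.Affine.CoordinateRing.mk (curve A B) g)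

/-- The last step of the procedure: `L'(x, -y) / (h_{-P} h_{-2P})` modulo `y² - f(x)`, where
`h_{-Q}(x, y) = -h_Q(x, -y)` and `h_{2P} = c y - (u₀ + u₁ x)` is given by the doubling formulas. -/
def recovered (A B α₁ α₀ : k) (L' : k[X][Y]) : (curve A B).FunctionField :=
  toFun A B (flipY L') /
    (toFun A B (-flipY (linePoly 1 α₁ α₀)) *
      toFun A B (-flipY (linePoly (c A B α₁ α₀) (u₁ A B α₁ α₀) (u₀ A B α₁ α₀))))

end Procedure

end TraceZero

end

noncomputable section

namespace TraceZero

/-! ## Integral forms of the tripling formulas -/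

/-! Let P₁, P₂, P₃ be the conjugates of P. The line ℓᵢ through Pᵢ and 2Pᵢ meets the curve a third
time in -3Pᵢ, so the divisor of ℓ₁ℓ₂ℓ₃ is that of h_P · h_{2P} · h_{-3P}. After y ↦ -y the product
is a constant times h_{-P} · h_{-2P} · h_{3P}, and dividing by the first two factors leaves h_{3P}.

The proof replaces divisors by explicit identities. The abscissas rᵢ of the Pᵢ are the roots of f -
(α₁x + α₀)², so a product over the three points is a norm from the cubic algebra generated by such a
root; it depends only on E₁, E₂, E₃ and makes sense when points coincide. With h = h_{-P} as a
variable, each flipped line is linear in h and x, and modulo the curve the norm of f - y² type terms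
becomes divisible by h. Comparing the six coefficients of the remaining quadratic form in h, x, 1
gives `exists_prod_lineForm_eq`.

For (a), numerator and denominator of L are symmetric in the rᵢ, so they are polynomials in e₁, e₂,
e₃; algebraic independence of these gives uniqueness (`IsSymmSubst.unique`). Substituting Eᵢ amounts
to evaluating at the actual roots in an algebraic closure, where the denominator is (-c)³
(`exists_isProcL_of_c_ne_zero`). The identity above then yields `procedure_correct`.

For (b), the line exists because the conjugates sum to zero. It is unique and Frobenius permutes the
conjugates, so its coefficients are fixed by Frobenius and lie in F (`existsUnique_isConjLine`).
Nonvanishing of d and c follows from 3d = ∏ψ₃(Pᵢ) and c = -8∏y(Pᵢ). That the tripling line cuts out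
exactly the 3Pᵢ (`isConjLine_three_nsmul`) combines the incidence `tripD_mul_y` with
`cubic_sub_tripling_line`, obtained by multiplying the line identity by its image under y ↦ -y; the
latter accounts for multiplicities. -/

/-- The polynomial `3 * d`, which has integral coefficients. -/
def tripD {R : Type*} [CommRing R] (A B α₁ α₀ : R) : R :=
    3 * α₁^8 * A^4 + 72 * α₁^7 * α₀ * A^2 * B - 36 * α₁^6 * α₀^2 * A^3 + 432 * α₁^6 * α₀^2 * B^2
    - 72 * α₁^6 * A^3 * B - 432 * α₁^6 * B^3 - 432 * α₁^5 * α₀^3 * A * B + 96 * α₁^5 * α₀ * A^4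
    + 432 * α₁^5 * α₀ * A * B^2 + 90 * α₁^4 * α₀^4 * A^2 + 360 * α₁^4 * α₀^2 * A^2 * B - 24 *
    α₁^4 * A^5 - 162 * α₁^4 * A^2 * B^2 - 216 * α₁^3 * α₀^5 * B + 2160 * α₁^3 * α₀^3 * B^2 - 288
    * α₁^3 * α₀ * A^3 * B - 1944 * α₁^3 * α₀ * B^3 + 108 * α₁^2 * α₀^6 * A - 1080 * α₁^2 * α₀^4
    * A * B + 144 * α₁^2 * α₀^2 * A^4 + 972 * α₁^2 * α₀^2 * A * B^2 + 288 * α₁ * α₀^5 * A^2 + 27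
    * α₀^8 + 216 * α₀^6 * B + 72 * α₀^4 * A^3 + 486 * α₀^4 * B^2 - 16 * A^6 - 216 * A^3 * B^2 -
    729 * B^4

/-- The polynomial `3 * v₁`, which has integral coefficients. -/
def tripV₁ {R : Type*} [CommRing R] (A B α₁ α₀ : R) : R :=
    α₁^9 * A^4 + 24 * α₁^8 * α₀ * A^2 * B - 12 * α₁^7 * α₀^2 * A^3 + 144 * α₁^7 * α₀^2 * B^2 +
    48 * α₁^7 * A^3 * B + 432 * α₁^7 * B^3 - 144 * α₁^6 * α₀^3 * A * B - 48 * α₁^6 * α₀ * A^4 -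
    720 * α₁^6 * α₀ * A * B^2 + 30 * α₁^5 * α₀^4 * A^2 + 576 * α₁^5 * α₀^2 * A^2 * B + 24 * α₁^5
    * A^5 + 162 * α₁^5 * A^2 * B^2 - 72 * α₁^4 * α₀^5 * B - 336 * α₁^4 * α₀^3 * A^3 + 432 * α₁^4
    * α₀^3 * B^2 + 288 * α₁^4 * α₀ * A^3 * B + 1944 * α₁^4 * α₀ * B^3 + 36 * α₁^3 * α₀^6 * A -
    720 * α₁^3 * α₀^4 * A * B - 144 * α₁^3 * α₀^2 * A^4 - 972 * α₁^3 * α₀^2 * A * B^2 - 96 *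
    α₁^3 * A^4 * B - 648 * α₁^3 * A * B^3 - 144 * α₁^2 * α₀^5 * A^2 + 192 * α₁^2 * α₀ * A^5 +
    1296 * α₁^2 * α₀ * A^2 * B^2 + 9 * α₁ * α₀^8 - 864 * α₁ * α₀^6 * B - 72 * α₁ * α₀^4 * A^3 -
    486 * α₁ * α₀^4 * B^2 + 864 * α₁ * α₀^2 * A^3 * B + 5832 * α₁ * α₀^2 * B^3 - 48 * α₁ * A^6 -
    648 * α₁ * A^3 * B^2 - 2187 * α₁ * B^4 + 144 * α₀^7 * A - 192 * α₀^3 * A^4 - 1296 * α₀^3 * A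
    * B^2

/-- The polynomial `3 * v₀`, which has integral coefficients. -/
def tripV₀ {R : Type*} [CommRing R] (A B α₁ α₀ : R) : R :=
    -8 * α₁^9 * A^3 * B - 64 * α₁^9 * B^3 + 9 * α₁^8 * α₀ * A^4 + 96 * α₁^8 * α₀ * A * B^2 - 48
    * α₁^7 * α₀^2 * A^2 * B - 24 * α₁^7 * A^2 * B^2 + 36 * α₁^6 * α₀^3 * A^3 + 48 * α₁^6 * α₀^3
    * B^2 + 24 * α₁^6 * α₀ * A^3 * B - 432 * α₁^6 * α₀ * B^3 + 24 * α₁^5 * α₀^4 * A * B + 864 *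
    α₁^5 * α₀^2 * A * B^2 + 96 * α₁^5 * A^4 * B + 648 * α₁^5 * A * B^3 + 30 * α₁^4 * α₀^5 * A^2
    - 600 * α₁^4 * α₀^3 * A^2 * B - 72 * α₁^4 * α₀ * A^5 - 486 * α₁^4 * α₀ * A^2 * B^2 + 96 *
    α₁^3 * α₀^6 * B + 192 * α₁^3 * α₀^4 * A^3 + 216 * α₁^3 * α₀^4 * B^2 + 576 * α₁^3 * α₀^2 *
    A^3 * B + 3888 * α₁^3 * α₀^2 * B^3 + 288 * α₁^3 * A^3 * B^2 + 1944 * α₁^3 * B^4 - 12 * α₁^2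
    * α₀^7 * A - 216 * α₁^2 * α₀^5 * A * B - 528 * α₁^2 * α₀^3 * A^4 - 3564 * α₁^2 * α₀^3 * A *
    B^2 - 576 * α₁^2 * α₀ * A^4 * B - 3888 * α₁^2 * α₀ * A * B^3 + 192 * α₁ * α₀^6 * A^2 + 384 *
    α₁ * α₀^2 * A^5 + 2592 * α₁ * α₀^2 * A^2 * B^2 + α₀^9 + 216 * α₀^7 * B - 360 * α₀^5 * A^3 -
    2430 * α₀^5 * B^2 + 576 * α₀^3 * A^3 * B + 3888 * α₀^3 * B^3 - 48 * α₀ * A^6 - 648 * α₀ *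
    A^3 * B^2 - 2187 * α₀ * B^4

/-- The only denominators in the tripling formulas are 3. Once cleared, the formulas make sense over
any commutative ring, so the identities can be proved by `ring` and applied in polynomial rings. -/
lemma three_mul_d {k : Type*} [Field k] (h3 : (3 : k) ≠ 0) (A B α₁ α₀ : k) :
    3 * d A B α₁ α₀ = tripD A B α₁ α₀ := by
  simp only [d, tripD]
  field_simp
  ring

lemma three_mul_v₁ {k : Type*} [Field k] (h3 : (3 : k) ≠ 0) (A B α₁ α₀ : k) :
    3 * v₁ A B α₁ α₀ = tripV₁ A B α₁ α₀ := by
  simp only [v₁, tripV₁]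
  field_simp
  ring

lemma three_mul_v₀ {k : Type*} [Field k] (h3 : (3 : k) ≠ 0) (A B α₁ α₀ : k) :
    3 * v₀ A B α₁ α₀ = tripV₀ A B α₁ α₀ := by
  simp only [v₀, tripV₀]
  field_simp
  ring

/-! ## Norms from the cubic algebra `R[r] / (r³ - e₁ r² + e₂ r - e₃)` -/

section Norm

variable {R : Type*} [CommRing R]

/-- The norm of `p₀ + p₁ r + p₂ r²`. -/
def norm₃ (e₁ e₂ e₃ p₀ p₁ p₂ : R) : R :=
  p₀ ^ 3 + e₁ * p₀ ^ 2 * p₁ + (e₁ ^ 2 - 2 * e₂) * p₀ ^ 2 * p₂ + e₂ * p₀ * p₁ ^ 2 +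
    (e₁ * e₂ - 3 * e₃) * p₀ * p₁ * p₂ + (e₂ ^ 2 - 2 * e₁ * e₃) * p₀ * p₂ ^ 2 + e₃ * p₁ ^ 3 +
    e₁ * e₃ * p₁ ^ 2 * p₂ + e₂ * e₃ * p₁ * p₂ ^ 2 + e₃ ^ 2 * p₂ ^ 3

/-- The part of the norm of `p + q` that is quadratic in `p` and linear in `q`. -/
def norm₂₁ (e₁ e₂ e₃ p₀ p₁ p₂ q₀ q₁ q₂ : R) : R :=
  q₀ * (3 * p₀ ^ 2 + 2 * e₁ * p₀ * p₁ + 2 * (e₁ ^ 2 - 2 * e₂) * p₀ * p₂ + e₂ * p₁ ^ 2 +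
      (e₁ * e₂ - 3 * e₃) * p₁ * p₂ + (e₂ ^ 2 - 2 * e₁ * e₃) * p₂ ^ 2) +
    q₁ * (e₁ * p₀ ^ 2 + 2 * e₂ * p₀ * p₁ + (e₁ * e₂ - 3 * e₃) * p₀ * p₂ + 3 * e₃ * p₁ ^ 2 +
      2 * e₁ * e₃ * p₁ * p₂ + e₂ * e₃ * p₂ ^ 2) +
    q₂ * ((e₁ ^ 2 - 2 * e₂) * p₀ ^ 2 + (e₁ * e₂ - 3 * e₃) * p₀ * p₁ +
      2 * (e₂ ^ 2 - 2 * e₁ * e₃) * p₀ * p₂ + e₁ * e₃ * p₁ ^ 2 + 2 * e₂ * e₃ * p₁ * p₂ +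
      3 * e₃ ^ 2 * p₂ ^ 2)

/-- The part of the norm of `p + q + s` that is linear in each of `p`, `q` and `s`. -/
def norm₁₁₁ (e₁ e₂ e₃ p₀ p₁ p₂ q₀ q₁ q₂ s₀ s₁ s₂ : R) : R :=
  s₀ * (q₀ * (6 * p₀ + 2 * e₁ * p₁ + 2 * (e₁ ^ 2 - 2 * e₂) * p₂) +
      q₁ * (2 * e₁ * p₀ + 2 * e₂ * p₁ + (e₁ * e₂ - 3 * e₃) * p₂) +
      q₂ * (2 * (e₁ ^ 2 - 2 * e₂) * p₀ + (e₁ * e₂ - 3 * e₃) * p₁ +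
        2 * (e₂ ^ 2 - 2 * e₁ * e₃) * p₂)) +
    s₁ * (q₀ * (2 * e₁ * p₀ + 2 * e₂ * p₁ + (e₁ * e₂ - 3 * e₃) * p₂) +
      q₁ * (2 * e₂ * p₀ + 6 * e₃ * p₁ + 2 * e₁ * e₃ * p₂) +
      q₂ * ((e₁ * e₂ - 3 * e₃) * p₀ + 2 * e₁ * e₃ * p₁ + 2 * e₂ * e₃ * p₂)) +
    s₂ * (q₀ * (2 * (e₁ ^ 2 - 2 * e₂) * p₀ + (e₁ * e₂ - 3 * e₃) * p₁ +
        2 * (e₂ ^ 2 - 2 * e₁ * e₃) * p₂) +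
      q₁ * ((e₁ * e₂ - 3 * e₃) * p₀ + 2 * e₁ * e₃ * p₁ + 2 * e₂ * e₃ * p₂) +
      q₂ * (2 * (e₂ ^ 2 - 2 * e₁ * e₃) * p₀ + 2 * e₂ * e₃ * p₁ + 6 * e₃ ^ 2 * p₂))

/-- This converts products over the three points into expressions in e₁, e₂, e₃. Nothing requires
the roots to be distinct. -/
lemma prod_eq_norm₃ {r₀ r₁ r₂ e₁ e₂ e₃ : R} (h₁ : r₀ + r₁ + r₂ = e₁)
    (h₂ : r₀ * r₁ + r₀ * r₂ + r₁ * r₂ = e₂) (h₃ : r₀ * r₁ * r₂ = e₃) (p₀ p₁ p₂ : R) :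
    (p₀ + p₁ * r₀ + p₂ * r₀ ^ 2) * (p₀ + p₁ * r₁ + p₂ * r₁ ^ 2) *
      (p₀ + p₁ * r₂ + p₂ * r₂ ^ 2) = norm₃ e₁ e₂ e₃ p₀ p₁ p₂ := by
  subst h₁ h₂ h₃
  simp only [norm₃]
  ring

/-- Polarization of the cubic form `norm₃`. With q a multiple of h it sorts the norm by powers of h;
`norm₂₁_add_left` then sorts by powers of x. -/
lemma norm₃_add (e₁ e₂ e₃ p₀ p₁ p₂ q₀ q₁ q₂ : R) :
    norm₃ e₁ e₂ e₃ (p₀ + q₀) (p₁ + q₁) (p₂ + q₂) =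
      norm₃ e₁ e₂ e₃ p₀ p₁ p₂ + norm₂₁ e₁ e₂ e₃ p₀ p₁ p₂ q₀ q₁ q₂ +
        norm₂₁ e₁ e₂ e₃ q₀ q₁ q₂ p₀ p₁ p₂ + norm₃ e₁ e₂ e₃ q₀ q₁ q₂ := by
  simp only [norm₃, norm₂₁]
  ring

lemma norm₂₁_add_right (e₁ e₂ e₃ p₀ p₁ p₂ q₀ q₁ q₂ s₀ s₁ s₂ : R) :
    norm₂₁ e₁ e₂ e₃ p₀ p₁ p₂ (q₀ + s₀) (q₁ + s₁) (q₂ + s₂) =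
      norm₂₁ e₁ e₂ e₃ p₀ p₁ p₂ q₀ q₁ q₂ + norm₂₁ e₁ e₂ e₃ p₀ p₁ p₂ s₀ s₁ s₂ := by
  simp only [norm₂₁]
  ring

lemma norm₂₁_add_left (e₁ e₂ e₃ p₀ p₁ p₂ q₀ q₁ q₂ s₀ s₁ s₂ : R) :
    norm₂₁ e₁ e₂ e₃ (p₀ + q₀) (p₁ + q₁) (p₂ + q₂) s₀ s₁ s₂ =
      norm₂₁ e₁ e₂ e₃ p₀ p₁ p₂ s₀ s₁ s₂ + norm₁₁₁ e₁ e₂ e₃ p₀ p₁ p₂ q₀ q₁ q₂ s₀ s₁ s₂ +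
        norm₂₁ e₁ e₂ e₃ q₀ q₁ q₂ s₀ s₁ s₂ := by
  simp only [norm₂₁, norm₁₁₁]
  ring

lemma norm₃_smul (e₁ e₂ e₃ t p₀ p₁ p₂ : R) :
    norm₃ e₁ e₂ e₃ (p₀ * t) (p₁ * t) (p₂ * t) = t ^ 3 * norm₃ e₁ e₂ e₃ p₀ p₁ p₂ := by
  simp only [norm₃]
  ring

lemma norm₂₁_smul (e₁ e₂ e₃ t s p₀ p₁ p₂ q₀ q₁ q₂ : R) :
    norm₂₁ e₁ e₂ e₃ (p₀ * t) (p₁ * t) (p₂ * t) (q₀ * s) (q₁ * s) (q₂ * s) =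
      t ^ 2 * s * norm₂₁ e₁ e₂ e₃ p₀ p₁ p₂ q₀ q₁ q₂ := by
  simp only [norm₂₁]
  ring

lemma norm₁₁₁_smul (e₁ e₂ e₃ t p₀ p₁ p₂ q₀ q₁ q₂ s₀ s₁ s₂ : R) :
    norm₁₁₁ e₁ e₂ e₃ (p₀ * t) (p₁ * t) (p₂ * t) q₀ q₁ q₂ s₀ s₁ s₂ =
      t * norm₁₁₁ e₁ e₂ e₃ p₀ p₁ p₂ q₀ q₁ q₂ s₀ s₁ s₂ := by
  simp only [norm₁₁₁]
  ring

/-- The coefficients of the reduction of `-r (p₀ + p₁ r + p₂ r²)` give the norm of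
`(p₀ + p₁ r + p₂ r²) (x - r)`. -/
lemma norm₃_mul_sub (e₁ e₂ e₃ x p₀ p₁ p₂ : R) :
    norm₃ e₁ e₂ e₃ (p₀ * x + -(e₃ * p₂)) (p₁ * x + (e₂ * p₂ - p₀)) (p₂ * x + (-p₁ - e₁ * p₂)) =
      norm₃ e₁ e₂ e₃ p₀ p₁ p₂ * (x ^ 3 - e₁ * x ^ 2 + e₂ * x - e₃) := by
  simp only [norm₃]
  ring

end Norm

/-! ## The line through `P` and `2P` -/

section Lines

variable {R : Type*} [CommRing R]

/-- The numerator `12 x y² - (3 x² + A)²` of `x(P) - x(2P)`; it is the third division polynomial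
on the curve. -/
def psiNum (A x y : R) : R := 12 * x * y ^ 2 - (3 * x ^ 2 + A) ^ 2

/-- The numerator of `y(2P) - y(P)`. -/
def slopeNum (A x y : R) : R := (3 * x ^ 2 + A) * psiNum A x y - 16 * y ^ 4

/-- The line through `P = (x₁, y₁)` and `2P`, with denominators cleared. -/
def lineForm (A x₁ y₁ x y : R) : R :=
  slopeNum A x₁ y₁ * (x - x₁) + 2 * y₁ * psiNum A x₁ y₁ * (y - y₁)

/-- A coefficient of the reduction of `slopeNum + 2 α₁ y psiNum` modulo the cubic of the line. -/
def slopeCoeff₀ (A B α₁ α₀ : R) : R :=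
    -α₁^6 * α₀^2 + α₁^6 * B - 10 * α₁^3 * α₀^3 + 10 * α₁^3 * α₀ * B + 9 * α₁^2 * α₀^2 * A - 9 *
    α₁^2 * A * B - 2 * α₁ * α₀ * A^2 - 7 * α₀^4 + 18 * α₀^2 * B - A^3 - 27 * B^2

/-- A coefficient of the reduction of `slopeNum + 2 α₁ y psiNum` modulo the cubic of the line. -/
def slopeCoeff₁ (A B α₁ α₀ : R) : R :=
    -2 * α₁^7 * α₀ + α₁^6 * A - 21 * α₁^4 * α₀^2 + α₁^4 * B + 28 * α₁^3 * α₀ * A - 11 * α₁^2 *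
    A^2 - 22 * α₁ * α₀^3 + 54 * α₁ * α₀ * B + 3 * α₀^2 * A - 27 * A * B

/-- A coefficient of the reduction of `slopeNum + 2 α₁ y psiNum` modulo the cubic of the line. -/
def slopeCoeff₂ (A B α₁ α₀ : R) : R :=
    -α₁^8 - 12 * α₁^5 * α₀ + 10 * α₁^4 * A - 24 * α₁^2 * α₀^2 + 36 * α₁^2 * B + 12 * α₁ * α₀ * A
    - 9 * A^2

/-- A coefficient of the reduction of `2 y psiNum` modulo the cubic of the line. -/
def vertCoeff₀ (A B α₁ α₀ : R) : R :=
    6 * α₁^5 * α₀^2 - 6 * α₁^5 * B + 18 * α₁^2 * α₀^3 - 18 * α₁^2 * α₀ * B + 6 * α₁ * α₀^2 * A -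
    6 * α₁ * A * B - 2 * α₀ * A^2

/-- A coefficient of the reduction of `2 y psiNum` modulo the cubic of the line. -/
def vertCoeff₁ (A B α₁ α₀ : R) : R :=
    12 * α₁^6 * α₀ - 6 * α₁^5 * A + 42 * α₁^3 * α₀^2 - 6 * α₁^3 * B - 6 * α₁^2 * α₀ * A - 8 * α₁
    * A^2 + 6 * α₀^3 + 18 * α₀ * B

/-- A coefficient of the reduction of `2 y psiNum` modulo the cubic of the line. -/
def vertCoeff₂ (A B α₁ α₀ : R) : R :=
    6 * α₁^7 + 30 * α₁^4 * α₀ + 18 * α₁ * α₀^2 + 18 * α₁ * B + 6 * α₀ * A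

/-- For y = h - α₁x - α₀ and a point of ordinate α₁r + α₀, the difference of ordinates is α₁(x - r)
- h. Hence the line is linear in x - r and h, and its coefficients can be reduced modulo the cubic
satisfied by r. -/
lemma lineForm_reduce {A B α₁ α₀ r : R}
    (hr : r ^ 3 - α₁ ^ 2 * r ^ 2 + (A - 2 * α₀ * α₁) * r - (α₀ ^ 2 - B) = 0) (x h : R) :
    lineForm A r (α₁ * r + α₀) x (-(h - α₁ * x - α₀)) =
      (slopeCoeff₀ A B α₁ α₀ + slopeCoeff₁ A B α₁ α₀ * r + slopeCoeff₂ A B α₁ α₀ * r ^ 2) *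
        (x - r) -
      (vertCoeff₀ A B α₁ α₀ + vertCoeff₁ A B α₁ α₀ * r + vertCoeff₂ A B α₁ α₀ * r ^ 2) * h := by
  have h₁ : slopeNum A r (α₁ * r + α₀) + α₁ * (2 * (α₁ * r + α₀) * psiNum A r (α₁ * r + α₀)) =
      slopeCoeff₀ A B α₁ α₀ + slopeCoeff₁ A B α₁ α₀ * r + slopeCoeff₂ A B α₁ α₀ * r ^ 2 := by
    simp only [slopeNum, psiNum, slopeCoeff₀, slopeCoeff₁, slopeCoeff₂]
    -- The multiplier is the quotient of the polynomial division by the cubic in r.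
    linear_combination
      (-α₁^6 - α₁^4 * r - 10 * α₁^3 * α₀ + 9 * α₁^2 * A - 9 * α₁^2 * r^2 + 9 * α₀^2 + 27 * B -
      27 * r^3) * hr
  have h₂ : 2 * (α₁ * r + α₀) * psiNum A r (α₁ * r + α₀) =
      vertCoeff₀ A B α₁ α₀ + vertCoeff₁ A B α₁ α₀ * r + vertCoeff₂ A B α₁ α₀ * r ^ 2 := by
    simp only [psiNum, vertCoeff₀, vertCoeff₁, vertCoeff₂]
    linear_combination
      (6 * α₁^5 + 6 * α₁^3 * r + 18 * α₁^2 * α₀ + 6 * α₁ * A - 18 * α₁ * r^2 - 18 * α₀ * r) * hr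
  simp only [lineForm]
  linear_combination (x - r) * h₁ - h * h₂

/-- The coefficient `c`, over a commutative ring. -/
def dblC (A B α₁ α₀ : R) : R := 8 * α₁^3 * B - 8 * α₁^2 * α₀ * A - 8 * α₀^3

/-- The coefficient `u₁`, over a commutative ring. -/
def dblU₁ (A B α₁ α₀ : R) : R :=
    4 * α₁^4 * B - 4 * α₁^3 * α₀ * A + 4 * α₁^2 * A^2 - 4 * α₁ * α₀^3 + 36 * α₁ * α₀ * B - 12 *
    α₀^2 * A

/-- The coefficient `u₀`, over a commutative ring. -/
def dblU₀ (A B α₁ α₀ : R) : R :=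
    -α₁^4 * A^2 - 8 * α₁^3 * α₀ * B + 2 * α₁^2 * α₀^2 * A + 6 * α₁^2 * A * B - 8 * α₁ * α₀ * A^2
    - α₀^4 - 18 * α₀^2 * B + 4 * A^3 + 27 * B^2

/-- The identities `lineCoeff_*` compare the coefficients of h², hx, h, x², x and 1 after a common
factor h has been removed. In terms of h, the two other factors are D h - (Dα₁ + V₁)x - (Dα₀ + V₀)
and c h + (u₁ - cα₁)x + (u₀ - cα₀), which explains the right-hand sides. -/
lemma lineCoeff_hh (A B α₁ α₀ : R) :
    norm₃ (α₁ ^ 2) (A - 2 * α₀ * α₁) (α₀ ^ 2 - B) (vertCoeff₀ A B α₁ α₀) (vertCoeff₁ A B α₁ α₀)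
    (vertCoeff₂ A B α₁ α₀) =
      -(tripD A B α₁ α₀ * dblC A B α₁ α₀) := by
  simp only [norm₃, vertCoeff₀, vertCoeff₁, vertCoeff₂, tripD, dblC]
  ring

lemma lineCoeff_hhx (A B α₁ α₀ : R) :
    norm₂₁ (α₁ ^ 2) (A - 2 * α₀ * α₁) (α₀ ^ 2 - B) (vertCoeff₀ A B α₁ α₀) (vertCoeff₁ A B α₁ α₀)
    (vertCoeff₂ A B α₁ α₀) (slopeCoeff₀ A B α₁ α₀) (slopeCoeff₁ A B α₁ α₀) (slopeCoeff₂ A B α₁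
    α₀) =
      tripD A B α₁ α₀ * (dblU₁ A B α₁ α₀ - dblC A B α₁ α₀ * α₁) - (tripD A B α₁ α₀ * α₁ + tripV₁
      A B α₁ α₀) * dblC A B α₁ α₀ := by
  simp only [norm₂₁, slopeCoeff₀, slopeCoeff₁, slopeCoeff₂, vertCoeff₀, vertCoeff₁, vertCoeff₂, tripD,
    tripV₁, dblC, dblU₁]
  ring

/-- The isolated `norm₃` term, here and in `lineCoeff_x` and `lineCoeff_one`, comes from ∏(x - rᵢ),
which equals h(h - 2(α₁x + α₀)) modulo the curve. -/
lemma lineCoeff_h (A B α₁ α₀ : R) :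
    norm₂₁ (α₁ ^ 2) (A - 2 * α₀ * α₁) (α₀ ^ 2 - B) (vertCoeff₀ A B α₁ α₀) (vertCoeff₁ A B α₁ α₀)
    (vertCoeff₂ A B α₁ α₀) (-((α₀ ^ 2 - B) * slopeCoeff₂ A B α₁ α₀)) ((A - 2 * α₀ * α₁) *
    slopeCoeff₂ A B α₁ α₀ - slopeCoeff₀ A B α₁ α₀) (-slopeCoeff₁ A B α₁ α₀ - α₁ ^ 2 *
    slopeCoeff₂ A B α₁ α₀) + norm₃ (α₁ ^ 2) (A - 2 * α₀ * α₁) (α₀ ^ 2 - B) (slopeCoeff₀ A B α₁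
    α₀) (slopeCoeff₁ A B α₁ α₀) (slopeCoeff₂ A B α₁ α₀) =
      tripD A B α₁ α₀ * (dblU₀ A B α₁ α₀ - dblC A B α₁ α₀ * α₀) - (tripD A B α₁ α₀ * α₀ + tripV₀
      A B α₁ α₀) * dblC A B α₁ α₀ := by
  simp only [norm₃, norm₂₁, slopeCoeff₀, slopeCoeff₁, slopeCoeff₂, vertCoeff₀, vertCoeff₁, vertCoeff₂, tripD,
    tripV₀, dblC, dblU₀]
  ring

lemma lineCoeff_xx (A B α₁ α₀ : R) :
    norm₂₁ (α₁ ^ 2) (A - 2 * α₀ * α₁) (α₀ ^ 2 - B) (slopeCoeff₀ A B α₁ α₀) (slopeCoeff₁ A B α₁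
    α₀) (slopeCoeff₂ A B α₁ α₀) (vertCoeff₀ A B α₁ α₀) (vertCoeff₁ A B α₁ α₀) (vertCoeff₂ A B α₁
    α₀) =
      (tripD A B α₁ α₀ * α₁ + tripV₁ A B α₁ α₀) * (dblU₁ A B α₁ α₀ - dblC A B α₁ α₀ * α₁) := by
  simp only [norm₂₁, slopeCoeff₀, slopeCoeff₁, slopeCoeff₂, vertCoeff₀, vertCoeff₁, vertCoeff₂, tripD,
    tripV₁, dblC, dblU₁]
  ring

lemma lineCoeff_x (A B α₁ α₀ : R) :
    norm₁₁₁ (α₁ ^ 2) (A - 2 * α₀ * α₁) (α₀ ^ 2 - B) (slopeCoeff₀ A B α₁ α₀) (slopeCoeff₁ A B α₁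
    α₀) (slopeCoeff₂ A B α₁ α₀) (-((α₀ ^ 2 - B) * slopeCoeff₂ A B α₁ α₀)) ((A - 2 * α₀ * α₁) *
    slopeCoeff₂ A B α₁ α₀ - slopeCoeff₀ A B α₁ α₀) (-slopeCoeff₁ A B α₁ α₀ - α₁ ^ 2 *
    slopeCoeff₂ A B α₁ α₀) (vertCoeff₀ A B α₁ α₀) (vertCoeff₁ A B α₁ α₀) (vertCoeff₂ A B α₁ α₀)
    + 2 * α₁ * norm₃ (α₁ ^ 2) (A - 2 * α₀ * α₁) (α₀ ^ 2 - B) (slopeCoeff₀ A B α₁ α₀)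
    (slopeCoeff₁ A B α₁ α₀) (slopeCoeff₂ A B α₁ α₀) =
      (tripD A B α₁ α₀ * α₁ + tripV₁ A B α₁ α₀) * (dblU₀ A B α₁ α₀ - dblC A B α₁ α₀ * α₀) +
      (tripD A B α₁ α₀ * α₀ + tripV₀ A B α₁ α₀) * (dblU₁ A B α₁ α₀ - dblC A B α₁ α₀ * α₁) := by
  simp only [norm₃, norm₁₁₁, slopeCoeff₀, slopeCoeff₁, slopeCoeff₂, vertCoeff₀, vertCoeff₁, vertCoeff₂,
    tripD, tripV₁, tripV₀, dblC, dblU₁, dblU₀]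
  ring

lemma lineCoeff_one (A B α₁ α₀ : R) :
    norm₂₁ (α₁ ^ 2) (A - 2 * α₀ * α₁) (α₀ ^ 2 - B) (-((α₀ ^ 2 - B) * slopeCoeff₂ A B α₁ α₀)) ((A
    - 2 * α₀ * α₁) * slopeCoeff₂ A B α₁ α₀ - slopeCoeff₀ A B α₁ α₀) (-slopeCoeff₁ A B α₁ α₀ - α₁
    ^ 2 * slopeCoeff₂ A B α₁ α₀) (vertCoeff₀ A B α₁ α₀) (vertCoeff₁ A B α₁ α₀) (vertCoeff₂ A B
    α₁ α₀) + 2 * α₀ * norm₃ (α₁ ^ 2) (A - 2 * α₀ * α₁) (α₀ ^ 2 - B) (slopeCoeff₀ A B α₁ α₀)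
    (slopeCoeff₁ A B α₁ α₀) (slopeCoeff₂ A B α₁ α₀) =
      (tripD A B α₁ α₀ * α₀ + tripV₀ A B α₁ α₀) * (dblU₀ A B α₁ α₀ - dblC A B α₁ α₀ * α₀) := by
  simp only [norm₃, norm₂₁, slopeCoeff₀, slopeCoeff₁, slopeCoeff₂, vertCoeff₀, vertCoeff₁, vertCoeff₂, tripD,
    tripV₀, dblC, dblU₀]
  ring

/-- The product of the three flipped lines through `Pᵢ` and `2Pᵢ` is, up to a multiple of the
equation of the curve, the product of `h_{-P}`, `h_{-2P}` and `3 h_{3P}`. -/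
lemma exists_prod_lineForm_eq {A B α₁ α₀ r₀ r₁ r₂ : R} (h₁ : r₀ + r₁ + r₂ = α₁ ^ 2)
    (h₂ : r₀ * r₁ + r₀ * r₂ + r₁ * r₂ = A - 2 * α₀ * α₁) (h₃ : r₀ * r₁ * r₂ = α₀ ^ 2 - B) (x y : R) :
    ∃ w : R, lineForm A r₀ (α₁ * r₀ + α₀) x (-y) * lineForm A r₁ (α₁ * r₁ + α₀) x (-y) *
        lineForm A r₂ (α₁ * r₂ + α₀) x (-y) =
      (y + (α₁ * x + α₀)) *
        (tripD A B α₁ α₀ * y - (tripV₁ A B α₁ α₀ * x + tripV₀ A B α₁ α₀)) *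
        (dblC A B α₁ α₀ * y + (dblU₁ A B α₁ α₀ * x + dblU₀ A B α₁ α₀)) +
      w * (y ^ 2 - (x ^ 3 + A * x + B)) := by
  -- Here h is h_{-P}, the factor to be split off.
  obtain ⟨h, rfl⟩ : ∃ h, y = h - α₁ * x - α₀ := ⟨y + α₁ * x + α₀, by ring⟩
  have hr₀ : r₀ ^ 3 - α₁ ^ 2 * r₀ ^ 2 + (A - 2 * α₀ * α₁) * r₀ - (α₀ ^ 2 - B) = 0 := by
    rw [← h₁, ← h₂, ← h₃]; ring
  have hr₁ : r₁ ^ 3 - α₁ ^ 2 * r₁ ^ 2 + (A - 2 * α₀ * α₁) * r₁ - (α₀ ^ 2 - B) = 0 := by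
    rw [← h₁, ← h₂, ← h₃]; ring
  have hr₂ : r₂ ^ 3 - α₁ ^ 2 * r₂ ^ 2 + (A - 2 * α₀ * α₁) * r₂ - (α₀ ^ 2 - B) = 0 := by
    rw [← h₁, ← h₂, ← h₃]; ring
  rw [lineForm_reduce hr₀, lineForm_reduce hr₁, lineForm_reduce hr₂]
  -- The coordinates of m(r)(x - r) use the reduction of -r·m(r) by the cubic; those of -t(r)h are
  -- added to them.
  have key : ∀ m₀ m₁ m₂ t₀ t₁ t₂ : R,
      ((m₀ + m₁ * r₀ + m₂ * r₀ ^ 2) * (x - r₀) - (t₀ + t₁ * r₀ + t₂ * r₀ ^ 2) * h) *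
      ((m₀ + m₁ * r₁ + m₂ * r₁ ^ 2) * (x - r₁) - (t₀ + t₁ * r₁ + t₂ * r₁ ^ 2) * h) *
      ((m₀ + m₁ * r₂ + m₂ * r₂ ^ 2) * (x - r₂) - (t₀ + t₁ * r₂ + t₂ * r₂ ^ 2) * h) =
      norm₃ (α₁ ^ 2) (A - 2 * α₀ * α₁) (α₀ ^ 2 - B)
        (m₀ * x + -((α₀ ^ 2 - B) * m₂) + t₀ * -h)
        (m₁ * x + ((A - 2 * α₀ * α₁) * m₂ - m₀) + t₁ * -h)
        (m₂ * x + (-m₁ - α₁ ^ 2 * m₂) + t₂ * -h) := by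
    intro m₀ m₁ m₂ t₀ t₁ t₂
    rw [← prod_eq_norm₃ h₁ h₂ h₃]
    congr 1
    · congr 1
      · linear_combination -m₂ * hr₀
      · linear_combination -m₂ * hr₁
    · linear_combination -m₂ * hr₂
  rw [key, norm₃_add, norm₃_mul_sub]
  have e1 := fun p₀ p₁ p₂ q₀ q₁ q₂ : R ↦ norm₂₁_smul (α₁ ^ 2) (A - 2 * α₀ * α₁) (α₀ ^ 2 - B) (-h) 1 p₀ p₁ p₂ q₀ q₁ q₂
  have e2 := fun p₀ p₁ p₂ q₀ q₁ q₂ : R ↦ norm₂₁_smul (α₁ ^ 2) (A - 2 * α₀ * α₁) (α₀ ^ 2 - B) 1 (-h) p₀ p₁ p₂ q₀ q₁ q₂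
  have e3 := fun p₀ p₁ p₂ q₀ q₁ q₂ : R ↦ norm₂₁_smul (α₁ ^ 2) (A - 2 * α₀ * α₁) (α₀ ^ 2 - B) (-h) x p₀ p₁ p₂ q₀ q₁ q₂
  have e4 := fun p₀ p₁ p₂ q₀ q₁ q₂ : R ↦ norm₂₁_smul (α₁ ^ 2) (A - 2 * α₀ * α₁) (α₀ ^ 2 - B) x (-h) p₀ p₁ p₂ q₀ q₁ q₂
  have e5 := fun p₀ p₁ p₂ q₀ q₁ q₂ s₀ s₁ s₂ : R ↦
    norm₁₁₁_smul (α₁ ^ 2) (A - 2 * α₀ * α₁) (α₀ ^ 2 - B) x p₀ p₁ p₂ q₀ q₁ q₂ (s₀ * -h) (s₁ * -h) (s₂ * -h)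
  have e6 : ∀ p₀ p₁ p₂ q₀ q₁ q₂ s₀ s₁ s₂ : R,
      norm₁₁₁ (α₁ ^ 2) (A - 2 * α₀ * α₁) (α₀ ^ 2 - B) p₀ p₁ p₂ q₀ q₁ q₂ (s₀ * -h) (s₁ * -h) (s₂ * -h) =
      -h * norm₁₁₁ (α₁ ^ 2) (A - 2 * α₀ * α₁) (α₀ ^ 2 - B) p₀ p₁ p₂ q₀ q₁ q₂ s₀ s₁ s₂ := by
    intros
    simp only [norm₁₁₁]
    ring
  simp only [mul_one] at e1 e2
  rw [norm₂₁_add_left, norm₂₁_add_right, e3, e4, e5, e6, e1, e2, norm₃_smul]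
  -- The multiple of the curve equation arises when f - (α₁x + α₀)² is replaced by y² - (α₁x + α₀)²
  -- in the term without h, whose coefficient is this norm.
  refine ⟨-norm₃ (α₁ ^ 2) (A - 2 * α₀ * α₁) (α₀ ^ 2 - B)
    (slopeCoeff₀ A B α₁ α₀) (slopeCoeff₁ A B α₁ α₀) (slopeCoeff₂ A B α₁ α₀), ?_⟩
  linear_combination (-h ^ 3) * lineCoeff_hh A B α₁ α₀ + h ^ 2 * x * lineCoeff_hhx A B α₁ α₀ +
    h ^ 2 * lineCoeff_h A B α₁ α₀ - h * x ^ 2 * lineCoeff_xx A B α₁ α₀ -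
    h * x * lineCoeff_x A B α₁ α₀ - h * lineCoeff_one A B α₁ α₀

end Lines

/-! ### Norms attached to doubling, to the ordinates and to the third division polynomial. -/

section Doubling

variable {R : Type*} [CommRing R]

/-- The doubling formulas: the product of the numerators of `x - x(2Pᵢ)`. -/
lemma prod_dblNum {A B α₁ α₀ r₀ r₁ r₂ : R} (h₁ : r₀ + r₁ + r₂ = α₁ ^ 2)
    (h₂ : r₀ * r₁ + r₀ * r₂ + r₁ * r₂ = A - 2 * α₀ * α₁) (h₃ : r₀ * r₁ * r₂ = α₀ ^ 2 - B) (x : R) :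
    (4 * (α₁ * r₀ + α₀) ^ 2 * (x - r₀) + psiNum A r₀ (α₁ * r₀ + α₀)) *
      (4 * (α₁ * r₁ + α₀) ^ 2 * (x - r₁) + psiNum A r₁ (α₁ * r₁ + α₀)) *
      (4 * (α₁ * r₂ + α₀) ^ 2 * (x - r₂) + psiNum A r₂ (α₁ * r₂ + α₀)) =
    dblC A B α₁ α₀ ^ 2 * (x ^ 3 + A * x + B) - (dblU₁ A B α₁ α₀ * x + dblU₀ A B α₁ α₀) ^ 2 := by
  have key : ∀ r : R, r ^ 3 - α₁ ^ 2 * r ^ 2 + (A - 2 * α₀ * α₁) * r - (α₀ ^ 2 - B) = 0 →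
      4 * (α₁ * r + α₀) ^ 2 * (x - r) + psiNum A r (α₁ * r + α₀) =
      (4 * α₀ ^ 2 * x + (-α₁^2 * α₀^2 + α₁^2 * B - A^2)) +
      (8 * α₀ * α₁ * x + (-2 * α₁^3 * α₀ + α₁^2 * A - α₀^2 + 9 * B)) * r +
      (4 * α₁ ^ 2 * x + (-α₁^4 - 2 * α₁ * α₀ + 3 * A)) * r ^ 2 := by
    intro r hr
    simp only [psiNum]
    linear_combination (-α₁^2 - 9 * r) * hr
  rw [key r₀ (by rw [← h₁, ← h₂, ← h₃]; ring), key r₁ (by rw [← h₁, ← h₂, ← h₃]; ring),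
    key r₂ (by rw [← h₁, ← h₂, ← h₃]; ring), prod_eq_norm₃ h₁ h₂ h₃]
  simp only [norm₃, dblC, dblU₁, dblU₀]
  ring

/-- The product of the `y(Pᵢ)`. -/
lemma eight_mul_prod_y {A B α₁ α₀ r₀ r₁ r₂ : R} (h₁ : r₀ + r₁ + r₂ = α₁ ^ 2)
    (h₂ : r₀ * r₁ + r₀ * r₂ + r₁ * r₂ = A - 2 * α₀ * α₁) (h₃ : r₀ * r₁ * r₂ = α₀ ^ 2 - B) :
    8 * ((α₁ * r₀ + α₀) * (α₁ * r₁ + α₀) * (α₁ * r₂ + α₀)) = -dblC A B α₁ α₀ := by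
  simp only [dblC]
  linear_combination 8 * α₁ ^ 3 * h₃ + 8 * α₁ ^ 2 * α₀ * h₂ + 8 * α₁ * α₀ ^ 2 * h₁

/-- The product of the third division polynomials at the `Pᵢ`. -/
lemma prod_psiNum {A B α₁ α₀ r₀ r₁ r₂ : R} (h₁ : r₀ + r₁ + r₂ = α₁ ^ 2)
    (h₂ : r₀ * r₁ + r₀ * r₂ + r₁ * r₂ = A - 2 * α₀ * α₁) (h₃ : r₀ * r₁ * r₂ = α₀ ^ 2 - B) :
    psiNum A r₀ (α₁ * r₀ + α₀) * psiNum A r₁ (α₁ * r₁ + α₀) * psiNum A r₂ (α₁ * r₂ + α₀) =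
      tripD A B α₁ α₀ := by
  have key : ∀ r : R, r ^ 3 - α₁ ^ 2 * r ^ 2 + (A - 2 * α₀ * α₁) * r - (α₀ ^ 2 - B) = 0 →
      psiNum A r (α₁ * r + α₀) = (3 * α₁ ^ 2 * α₀ ^ 2 - 3 * α₁ ^ 2 * B - A ^ 2) +
        (6 * α₁ ^ 3 * α₀ - 3 * α₁ ^ 2 * A + 3 * α₀ ^ 2 + 9 * B) * r +
        (3 * α₁ ^ 4 + 6 * α₁ * α₀ + 3 * A) * r ^ 2 := by
    intro r hr
    simp only [psiNum]
    linear_combination (3 * α₁ ^ 2 - 9 * r) * hr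
  rw [key r₀ (by rw [← h₁, ← h₂, ← h₃]; ring), key r₁ (by rw [← h₁, ← h₂, ← h₃]; ring),
    key r₂ (by rw [← h₁, ← h₂, ← h₃]; ring), prod_eq_norm₃ h₁ h₂ h₃]
  simp only [norm₃, tripD]
  ring

end Doubling

/-! ### Incidence of 3P with the tripling line, and the norm of a single line. -/

section Tripling

variable {R : Type*} [CommRing R]

/-- The cofactor of the third division polynomial in `3 d`, at a point `(r, y)` of the line. -/
def tripCofactor (A α₁ r y : R) : R :=
    81 * r^8 + 162 * r^6 * α₁^4 + 270 * r^6 * A - 216 * r^5 * y^2 + 216 * r^5 * α₁^6 - 324 * r^4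
    * y^2 * α₁^2 - 864 * r^4 * y * α₁^5 - 27 * r^4 * α₁^8 + 324 * r^4 * α₁^4 * A + 297 * r^4 *
    A^2 + 216 * r^3 * y^3 * α₁ + 756 * r^3 * y^2 * α₁^4 - 468 * r^3 * y^2 * A + 144 * r^3 * α₁^6
    * A + 144 * r^2 * y^4 - 504 * r^2 * y^3 * α₁^3 + 36 * r^2 * y^2 * α₁^6 - 540 * r^2 * y^2 *
    α₁^2 * A - 576 * r^2 * y * α₁^5 * A - 18 * r^2 * α₁^8 * A + 162 * r^2 * α₁^4 * A^2 + 120 *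
    r^2 * A^3 + 576 * r * y^4 * α₁^2 + 360 * r * y^3 * α₁^5 + 288 * r * y^3 * α₁ * A + 36 * r *
    y^2 * α₁^8 + 36 * r * y^2 * α₁^4 * A - 240 * r * y^2 * A^2 + 24 * r * α₁^6 * A^2 - 288 * y^5
    * α₁ - 288 * y^4 * α₁^4 + 144 * y^4 * A - 72 * y^3 * α₁^7 + 288 * y^3 * α₁^3 * A + 108 * y^2
    * α₁^6 * A - 144 * y^2 * α₁^2 * A^2 - 96 * y * α₁^5 * A^2 - 3 * α₁^8 * A^2 + 24 * α₁^4 * A^3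
    + 16 * A^4

/-- The quotient of the value of `3 h_{3P}` at `-P` by `4 y q`, where `q` is the numerator
of `y(2P)`. -/
def tripQuotient (A α₁ r y : R) : R :=
    -27 * r^6 + 54 * r^4 * y * α₁ - 54 * r^4 * α₁^4 - 81 * r^4 * A + 36 * r^3 * y^2 + 144 * r^3
    * y * α₁^3 - 72 * r^3 * α₁^6 - 180 * r^2 * y^2 * α₁^2 + 252 * r^2 * y * α₁^5 + 144 * r^2 * y
    * α₁ * A + 9 * r^2 * α₁^8 - 90 * r^2 * α₁^4 * A - 72 * r^2 * A^2 - 324 * r * y^2 * α₁^4 + 48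
    * r * y^2 * A + 192 * r * y * α₁^3 * A - 24 * r * α₁^6 * A - 16 * y^4 + 192 * y^3 * α₁^3 -
    12 * y^2 * α₁^6 - 240 * y^2 * α₁^2 * A - 2 * y * α₁^9 + 48 * y * α₁^5 * A + 96 * y * α₁ *
    A^2 + 3 * α₁^8 * A - 24 * α₁^4 * A^2 - 16 * A^3

/-- The values A, α₁, r, y can be taken as free parameters, since the curve and line equations
determine B and α₀. The identities are then plain polynomial identities. Divisibility by ψ₃(P) is
expected, because 3d is the product of the ψ₃(Pᵢ). -/
lemma tripD_eq_psiNum_mul (A α₁ r y : R) :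
    tripD A (y ^ 2 - r ^ 3 - A * r) α₁ (y - α₁ * r) = psiNum A r y * tripCofactor A α₁ r y := by
  simp only [tripD, psiNum, tripCofactor]
  ring

lemma tripCofactor_mul_slopeNum (A α₁ r y : R) :
    tripCofactor A α₁ r y * slopeNum A r y -
        2 * tripV₁ A (y ^ 2 - r ^ 3 - A * r) α₁ (y - α₁ * r) * y =
      psiNum A r y ^ 2 * tripQuotient A α₁ r y := by
  simp only [tripV₁, slopeNum, psiNum, tripCofactor, tripQuotient]
  ring

lemma tripLine_neg (A α₁ r y : R) :
    tripD A (y ^ 2 - r ^ 3 - A * r) α₁ (y - α₁ * r) * y +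
        tripV₁ A (y ^ 2 - r ^ 3 - A * r) α₁ (y - α₁ * r) * r +
        tripV₀ A (y ^ 2 - r ^ 3 - A * r) α₁ (y - α₁ * r) =
      -(4 * y * (slopeNum A r y + 8 * y ^ 4) * tripQuotient A α₁ r y) := by
  simp only [tripD, tripV₁, tripV₀, slopeNum, psiNum, tripQuotient]
  ring

/-- The point `3P` lies on the line given by the tripling formulas. -/
lemma tripD_mul_y {k : Type*} [Field k] {A B α₁ α₀ r y : k} (hy : y = α₁ * r + α₀)
    (hc : y ^ 2 = r ^ 3 + A * r + B) (hψ : psiNum A r y ≠ 0) :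
    tripD A B α₁ α₀ *
        -(y + 4 * y * slopeNum A r y * (slopeNum A r y + 8 * y ^ 4) / psiNum A r y ^ 3) =
      tripV₁ A B α₁ α₀ * (r - 8 * y ^ 2 * (slopeNum A r y + 8 * y ^ 4) / psiNum A r y ^ 2) +
        tripV₀ A B α₁ α₀ := by
  obtain rfl : α₀ = y - α₁ * r := by rw [hy]; ring
  obtain rfl : B = y ^ 2 - r ^ 3 - A * r := by rw [hc]; ring
  have h₁ := tripD_eq_psiNum_mul A α₁ r y
  have h₂ := tripCofactor_mul_slopeNum A α₁ r y
  have h₃ := tripLine_neg A α₁ r y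
  generalize tripD A (y ^ 2 - r ^ 3 - A * r) α₁ (y - α₁ * r) = D at *
  generalize tripV₁ A (y ^ 2 - r ^ 3 - A * r) α₁ (y - α₁ * r) = V₁ at *
  generalize tripV₀ A (y ^ 2 - r ^ 3 - A * r) α₁ (y - α₁ * r) = V₀ at *
  generalize tripQuotient A α₁ r y = T at *
  generalize tripCofactor A α₁ r y = κ at *
  generalize slopeNum A r y = m at *
  generalize psiNum A r y = ψ at *
  field_simp
  -- When y ≠ 0, 3P lies on the line through -P of slope m/(2yψ). The value of D y - V₁x - V₀ at 3P
  -- is its value at -P, from `h₃`, plus (κm - 2V₁y)/(2y) times x(3P) - r, from `h₁` and `h₂`; the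
  -- common factor T makes the two cancel.
  linear_combination (-ψ ^ 3) * h₃ - 4 * y * (m + 8 * y ^ 4) * m * h₁ -
    4 * y * (m + 8 * y ^ 4) * ψ * h₂

/-- The norm of the line through `P` and `2P`. -/
lemma lineForm_mul_lineForm_neg {A B r y s t : R} (hc : y ^ 2 = r ^ 3 + A * r + B)
    (hC : t ^ 2 = s ^ 3 + A * s + B) :
    lineForm A r y s t * lineForm A r y s (-t) =
      -((s - r) * (4 * y ^ 2 * (s - r) + psiNum A r y) *
        (psiNum A r y ^ 2 * (s - r) + 8 * y ^ 2 * (slopeNum A r y + 8 * y ^ 4))) := by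
  have hB : B = y ^ 2 - r ^ 3 - A * r := by rw [hc]; ring
  have hm : slopeNum A r y = (3 * r ^ 2 + A) * psiNum A r y - 16 * y ^ 4 := rfl
  have hψ : psiNum A r y = 12 * r * y ^ 2 - (3 * r ^ 2 + A) ^ 2 := rfl
  -- The product is even in t, so it is a polynomial in s. Its factors are the numerators of s -
  -- x(P), s - x(2P) and s - x(3P), reflecting the intersection points P, 2P, -3P.
  have : lineForm A r y s t * lineForm A r y s (-t) =
      (slopeNum A r y * (s - r) - 2 * y ^ 2 * psiNum A r y) ^ 2 -
        4 * y ^ 2 * psiNum A r y ^ 2 * (s ^ 3 + A * s + (y ^ 2 - r ^ 3 - A * r)) := by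
    rw [← hB, ← hC]
    simp only [lineForm]
    ring
  rw [this, hm, hψ]
  ring

end Tripling

/-! ## The substitution in the elementary symmetric polynomials -/

section SymmSubst

variable {k : Type*} [Field k]

/-- This is the algebraic independence of the elementary symmetric polynomials, on which uniqueness
of the substitution rests. -/
lemma inEsymm_injective : Function.Injective (inEsymm (k := k)) := by
  refine (IsFractionRing.injective (MvPolynomial (Fin 3) k) (RatFun₃ k)).comp ?_
  intro p q h
  apply MvPolynomial.esymmAlgHom_injective (σ := Fin 3) (R := k) (n := 3) (by simp)
  apply Subtype.ext
  rw [MvPolynomial.esymmAlgHom_apply, MvPolynomial.esymmAlgHom_apply]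
  exact h

/-- Cross-multiplication with b and b' as inverses of a and a'; the denominators are constants in a
polynomial ring, which is not a field. -/
lemma mul_eq_mul_iff_of_mul_eq_one {R : Type*} [CommRing R] {a a' b b' : R} (h : a * b = 1)
    (h' : a' * b' = 1) (n n' : R) : b * n = b' * n' ↔ a' * n = a * n' :=
  ⟨fun e ↦ by linear_combination a * a' * e - a' * n * h + a * n' * h',
    fun e ↦ by linear_combination b * b' * e - b * n * h' + b' * n' * h⟩

lemma C_C_mul_C_C_inv {K : Type*} [Field K] {a : K} (ha : a ≠ 0) :
    (C (C a) * C (C a⁻¹) : K[X][Y]) = 1 := by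
  rw [← C_mul, ← C_mul, mul_inv_cancel₀ ha, C_1, C_1]

lemma IsSymmSubst.unique {E : Fin 3 → k} {L : (RatFun₃ k)[X][Y]} {L₁ L₂ : k[X][Y]}
    (h₁ : IsSymmSubst E L L₁) (h₂ : IsSymmSubst E L L₂) : L₁ = L₂ := by
  obtain ⟨N, D, hD, hL, rfl⟩ := h₁
  obtain ⟨N', D', hD', hL', rfl⟩ := h₂
  have hne : ∀ D : MvPolynomial (Fin 3) k, MvPolynomial.eval E D ≠ 0 → inEsymm D ≠ 0 := by
    intro D hD h
    rw [map_eq_zero_iff _ inEsymm_injective] at h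
    simp [h] at hD
  -- Cross-multiplied, the two representations agree as polynomials in e₁, e₂, e₃, so both can be
  -- evaluated at E.
  have key : C (C D') * N = C (C D) * N' := by
    apply Polynomial.map_injective (mapRingHom inEsymm)
      (Polynomial.map_injective _ (inEsymm_injective (k := k)))
    rw [Polynomial.map_mul, Polynomial.map_mul, Polynomial.map_C, Polynomial.map_C,
      coe_mapRingHom, Polynomial.map_C, Polynomial.map_C]
    exact (mul_eq_mul_iff_of_mul_eq_one (C_C_mul_C_C_inv (hne D hD))
      (C_C_mul_C_C_inv (hne D' hD')) _ _).mp (hL.symm.trans hL')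
  have key' := congrArg (Polynomial.map (mapRingHom (MvPolynomial.eval E))) key
  rw [Polynomial.map_mul, Polynomial.map_mul, Polynomial.map_C, Polynomial.map_C,
    coe_mapRingHom, Polynomial.map_C, Polynomial.map_C] at key'
  exact (mul_eq_mul_iff_of_mul_eq_one (C_C_mul_C_C_inv hD) (C_C_mul_C_C_inv hD') _ _).mpr key'

/-- Every symmetric polynomial is a polynomial in the elementary symmetric ones. -/
lemma exists_aeval_esymm {p : MvPolynomial (Fin 3) k} (hp : p.IsSymmetric) :
    ∃ q : MvPolynomial (Fin 3) k,
      MvPolynomial.aeval (fun i : Fin 3 ↦ MvPolynomial.esymm (Fin 3) k (i + 1)) q = p := by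
  obtain ⟨q, hq⟩ := MvPolynomial.esymmAlgHom_surjective (σ := Fin 3) (R := k) (n := 3) (by simp)
    ⟨p, hp⟩
  refine ⟨q, ?_⟩
  rw [← MvPolynomial.esymmAlgHom_apply, hq]

lemma exists_map_aeval_esymm {T : (MvPolynomial (Fin 3) k)[X][Y]}
    (hT : ∀ e : Equiv.Perm (Fin 3),
      T.map (mapRingHom (MvPolynomial.rename (R := k) e).toRingHom) = T) :
    ∃ N : (MvPolynomial (Fin 3) k)[X][Y], N.map (mapRingHom
      (MvPolynomial.aeval fun i : Fin 3 ↦ MvPolynomial.esymm (Fin 3) k (i + 1)).toRingHom) = T := by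
  set φ : MvPolynomial (Fin 3) k →+* MvPolynomial (Fin 3) k :=
    (MvPolynomial.aeval fun i : Fin 3 ↦ MvPolynomial.esymm (Fin 3) k (i + 1)).toRingHom with hφ
  refine (mem_lifts _).mp ((lifts_iff_coeff_lifts T).mpr fun n ↦ ?_)
  refine (mem_lifts _).mp ((lifts_iff_coeff_lifts (T.coeff n)).mpr fun m ↦ ?_)
  refine exists_aeval_esymm fun e ↦ ?_
  conv_rhs => rw [← hT e]
  simp

/-- Substituting Eᵢ for eᵢ is the same as substituting roots ρ with these elementary symmetric
functions, even if the roots lie only in an extension. -/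
lemma aeval_aeval_esymm {K : Type*} [Field K] [Algebra k K] {E : Fin 3 → k} {ρ : Fin 3 → K}
    (hρ : ∀ i : Fin 3,
      MvPolynomial.aeval ρ (MvPolynomial.esymm (Fin 3) k (i + 1)) = algebraMap k K (E i)) :
    (MvPolynomial.aeval ρ : MvPolynomial (Fin 3) k →ₐ[k] K).toRingHom.comp
        (MvPolynomial.aeval fun i : Fin 3 ↦ MvPolynomial.esymm (Fin 3) k (i + 1)).toRingHom =
      (algebraMap k K).comp (MvPolynomial.eval E) := by
  apply MvPolynomial.ringHom_ext
  · intro a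
    simp
  · intro i
    simpa using hρ i

end SymmSubst

/-! ## The product of the lines -/

lemma lineForm_map {R S : Type*} [CommRing R] [CommRing S] (φ : R →+* S) (A a b : R) :
    (lineForm (C (C A)) (C (C a)) (C (C b)) (C X) Y).map (mapRingHom φ) =
      lineForm (C (C (φ A))) (C (C (φ a))) (C (C (φ b))) (C X) Y := by
  simp [lineForm, slopeNum, psiNum]

/-- The coefficients of the line have denominators 4y² and 8y³, so (2y)³ clears both. -/
lemma ell_eq {M : Type*} [Field M] (h2 : (2 : M) ≠ 0) (A x y : M) (hy : y ≠ 0) :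
    ell A x y = C (C ((2 * y) ^ 3)⁻¹) * lineForm (C (C A)) (C (C x)) (C (C y)) (C X) Y := by
  have hx : x - dblX A x y = ((2 * y) ^ 3)⁻¹ * (2 * y * psiNum A x y) := by
    simp only [dblX, psiNum]
    field_simp
    ring
  have hy' : dblY A x y - y = ((2 * y) ^ 3)⁻¹ * slopeNum A x y := by
    have : dblY A x y - y = (3 * x ^ 2 + A) / (2 * y) * (x - dblX A x y) - 2 * y := by
      simp only [dblY]
      ring
    rw [this, hx]
    simp only [slopeNum]
    field_simp
    ring
  have h : ell A x y = C (C (dblY A x y - y)) * (C X - C (C x)) +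
      C (C (x - dblX A x y)) * (Y - C (C y)) := by
    simp only [ell, map_add, map_sub, map_mul]
    ring
  rw [h, hx, hy']
  simp only [lineForm, slopeNum, psiNum, map_mul, map_add, map_sub, map_pow, map_ofNat]
  ring

section Procedure

variable {k : Type*} [Field k]

/-- The numerator of `prodL`. -/
def prodLNum (A α₁ α₀ : k) : (MvPolynomial (Fin 3) k)[X][Y] :=
  ∏ i : Fin 3, lineForm (C (C (MvPolynomial.C A))) (C (C (MvPolynomial.X i)))
    (C (C (MvPolynomial.C α₁ * MvPolynomial.X i + MvPolynomial.C α₀))) (C X) Y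

/-- The denominator of `prodL`. -/
def prodLDen (α₁ α₀ : k) : MvPolynomial (Fin 3) k :=
  ∏ i : Fin 3, (2 * (MvPolynomial.C α₁ * MvPolynomial.X i + MvPolynomial.C α₀)) ^ 3

lemma prod_ell_eq {M : Type*} [Field M] (h2 : (2 : M) ≠ 0) (φ : MvPolynomial (Fin 3) k →+* M)
    (hφ : Function.Injective φ) (A : k) {α₁ α₀ : k} (hα : α₁ ≠ 0 ∨ α₀ ≠ 0) :
    ∏ i : Fin 3, ell (φ (MvPolynomial.C A)) (φ (MvPolynomial.X i))
        (φ (MvPolynomial.C α₁ * MvPolynomial.X i + MvPolynomial.C α₀)) =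
      C (C (φ (prodLDen α₁ α₀))⁻¹) * (prodLNum A α₁ α₀).map (mapRingHom φ) := by
  -- If α₁X + α₀ were zero, its values at 0 and 1 would give α₀ = 0 and then α₁ = 0.
  have hy : ∀ i : Fin 3, φ (MvPolynomial.C α₁ * MvPolynomial.X i + MvPolynomial.C α₀) ≠ 0 := by
    intro i h
    rw [map_eq_zero_iff _ hφ] at h
    have h0 := congrArg (MvPolynomial.eval (fun _ ↦ (0 : k))) h
    have h1 := congrArg (MvPolynomial.eval (fun _ ↦ (1 : k))) h
    simp only [map_add, map_mul, MvPolynomial.eval_C, MvPolynomial.eval_X, mul_zero, zero_add,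
      map_zero, mul_one] at h0 h1
    rw [h0, add_zero] at h1
    rcases hα with h | h <;> contradiction
  have hden : φ (prodLDen α₁ α₀) = ∏ i : Fin 3,
      (2 * φ (MvPolynomial.C α₁ * MvPolynomial.X i + MvPolynomial.C α₀)) ^ 3 := by
    rw [prodLDen, map_prod]
    exact Finset.prod_congr rfl fun i _ ↦ by rw [map_pow, map_mul, map_ofNat]
  have hnum : (prodLNum A α₁ α₀).map (mapRingHom φ) = ∏ i : Fin 3,
      lineForm (C (C (φ (MvPolynomial.C A)))) (C (C (φ (MvPolynomial.X i))))
        (C (C (φ (MvPolynomial.C α₁ * MvPolynomial.X i + MvPolynomial.C α₀)))) (C X) Y := by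
    rw [prodLNum, Polynomial.map_prod]
    exact Finset.prod_congr rfl fun i _ ↦ lineForm_map φ _ _ _
  have hell : ∀ i, ell (φ (MvPolynomial.C A)) (φ (MvPolynomial.X i))
      (φ (MvPolynomial.C α₁ * MvPolynomial.X i + MvPolynomial.C α₀)) = _ :=
    fun i ↦ ell_eq h2 _ _ _ (hy i)
  rw [hden, hnum, ← Finset.prod_inv_distrib, map_prod, map_prod, ← Finset.prod_mul_distrib]
  exact Finset.prod_congr rfl fun i _ ↦ hell i

lemma prodL_eq (h2 : (2 : k) ≠ 0) (A : k) {α₁ α₀ : k} (hα : α₁ ≠ 0 ∨ α₀ ≠ 0) :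
    prodL A α₁ α₀ =
      C (C (algebraMap _ (RatFun₃ k) (prodLDen α₁ α₀))⁻¹) *
        (prodLNum A α₁ α₀).map (mapRingHom (algebraMap _ (RatFun₃ k))) := by
  have h2' : (2 : RatFun₃ k) ≠ 0 := by
    have := (map_ne_zero (algebraMap k (RatFun₃ k))).mpr h2
    rwa [map_ofNat] at this
  exact prod_ell_eq h2' _ (IsFractionRing.injective (MvPolynomial (Fin 3) k) (RatFun₃ k)) A hα

lemma prodLNum_symm (A α₁ α₀ : k) (e : Equiv.Perm (Fin 3)) :
    (prodLNum A α₁ α₀).map (mapRingHom (MvPolynomial.rename (R := k) e).toRingHom) =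
      prodLNum A α₁ α₀ := by
  rw [prodLNum, Polynomial.map_prod]
  conv_rhs => rw [← Equiv.prod_comp e]
  refine Finset.prod_congr rfl fun i _ ↦ ?_
  rw [lineForm_map]
  simp

lemma prodLDen_symm (α₁ α₀ : k) : (prodLDen α₁ α₀).IsSymmetric := by
  intro e
  rw [prodLDen, map_prod]
  conv_rhs => rw [← Equiv.prod_comp e]
  refine Finset.prod_congr rfl fun i _ ↦ ?_
  simp [map_ofNat]

lemma aeval_esymm_fin_three {K : Type*} [CommRing K] [Algebra k K] (ρ : Fin 3 → K) :
    MvPolynomial.aeval ρ (MvPolynomial.esymm (Fin 3) k 1) = ρ 0 + ρ 1 + ρ 2 ∧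
      MvPolynomial.aeval ρ (MvPolynomial.esymm (Fin 3) k 2) =
        ρ 0 * ρ 1 + ρ 0 * ρ 2 + ρ 1 * ρ 2 ∧
      MvPolynomial.aeval ρ (MvPolynomial.esymm (Fin 3) k 3) = ρ 0 * ρ 1 * ρ 2 := by
  have h₁ : Finset.powersetCard 1 (Finset.univ : Finset (Fin 3)) = {{0}, {1}, {2}} := by decide
  have h₂ : Finset.powersetCard 2 (Finset.univ : Finset (Fin 3)) = {{0, 1}, {0, 2}, {1, 2}} := by
    decide
  have h₃ : Finset.powersetCard 3 (Finset.univ : Finset (Fin 3)) = {{0, 1, 2}} := by decide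
  have n₁ : ({0} : Finset (Fin 3)) ∉ ({{1}, {2}} : Finset (Finset (Fin 3))) := by decide
  have n₂ : ({0, 1} : Finset (Fin 3)) ∉ ({{0, 2}, {1, 2}} : Finset (Finset (Fin 3))) := by decide
  have n₃ : ({0, 2} : Finset (Fin 3)) ∉ ({{1, 2}} : Finset (Finset (Fin 3))) := by decide
  refine ⟨?_, ?_, ?_⟩
  · rw [MvPolynomial.esymm, h₁, Finset.sum_insert n₁]
    simp [add_assoc]
  · rw [MvPolynomial.esymm, h₂, Finset.sum_insert n₂, Finset.sum_insert n₃]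
    simp [add_assoc]
  · rw [MvPolynomial.esymm, h₃]
    simp [mul_assoc]

/-- The procedure can be run as soon as the `y`-coordinates of the intersection points of the
line and the curve do not vanish, and its outcome is the product of the lines through
`Pᵢ` and `2Pᵢ`. -/
lemma exists_isProcL {K : Type*} [Field K] [Algebra k K] (h2 : (2 : k) ≠ 0) {A B α₁ α₀ : k}
    {ρ : Fin 3 → K} (h₁ : ρ 0 + ρ 1 + ρ 2 = algebraMap k K (α₁ ^ 2))
    (h₂ : ρ 0 * ρ 1 + ρ 0 * ρ 2 + ρ 1 * ρ 2 = algebraMap k K (A - 2 * α₀ * α₁))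
    (h₃ : ρ 0 * ρ 1 * ρ 2 = algebraMap k K (α₀ ^ 2 - B))
    (hy : ∀ i, algebraMap k K α₁ * ρ i + algebraMap k K α₀ ≠ 0) :
    ∃ L : k[X][Y], IsProcL A B α₁ α₀ L ∧
      L.map (mapRingHom (algebraMap k K)) =
        C (C (∏ i, (2 * (algebraMap k K α₁ * ρ i + algebraMap k K α₀)) ^ 3)⁻¹) *
          ∏ i, lineForm (C (C (algebraMap k K A))) (C (C (ρ i)))
            (C (C (algebraMap k K α₁ * ρ i + algebraMap k K α₀))) (C X) Y := by
  obtain ⟨N, hN⟩ := exists_map_aeval_esymm (prodLNum_symm A α₁ α₀)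
  obtain ⟨D, hD⟩ := exists_aeval_esymm (prodLDen_symm α₁ α₀)
  set E : Fin 3 → k := ![α₁ ^ 2, A - 2 * α₀ * α₁, α₀ ^ 2 - B] with hE
  have hα : α₁ ≠ 0 ∨ α₀ ≠ 0 := by
    by_contra! h
    exact hy 0 (by simp [h.1, h.2])
  have hcomp := aeval_aeval_esymm (k := k) (K := K) (E := E) (ρ := ρ) <| by
    intro i
    obtain ⟨e₁, e₂, e₃⟩ := aeval_esymm_fin_three (k := k) ρ
    fin_cases i
    exacts [e₁.trans h₁, e₂.trans h₂, e₃.trans h₃]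
  -- Evaluated through the roots, the denominator is the product of the (2yᵢ)³, hence nonzero.
  have hDE : algebraMap k K (MvPolynomial.eval E D) =
      ∏ i, (2 * (algebraMap k K α₁ * ρ i + algebraMap k K α₀)) ^ 3 := by
    have := congrArg (fun φ ↦ φ D) hcomp
    simp only [RingHom.comp_apply, AlgHom.toRingHom_eq_coe, RingHom.coe_coe, hD] at this
    rw [← this, prodLDen]
    simp [map_ofNat]
  have h2K : (2 : K) ≠ 0 := by
    have := (map_ne_zero (algebraMap k K)).mpr h2
    rwa [map_ofNat] at this
  have hDE0 : MvPolynomial.eval E D ≠ 0 := by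
    rw [← map_ne_zero (algebraMap k K), hDE]
    exact Finset.prod_ne_zero_iff.mpr fun i _ ↦ pow_ne_zero _ (mul_ne_zero h2K (hy i))
  refine ⟨_, ⟨N, D, hDE0, ?_, rfl⟩, ?_⟩
  · have hin : inEsymm (k := k) = (algebraMap (MvPolynomial (Fin 3) k) (RatFun₃ k)).comp
        (MvPolynomial.aeval fun i : Fin 3 ↦ MvPolynomial.esymm (Fin 3) k (i + 1)).toRingHom := rfl
    rw [prodL_eq h2 A hα, ← hN, ← hD, Polynomial.map_map, mapRingHom_comp, hin,
      RingHom.comp_apply]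
    rfl
  · have hnum : (N.map (mapRingHom (MvPolynomial.eval E))).map (mapRingHom (algebraMap k K)) =
        ∏ i, lineForm (C (C (algebraMap k K A))) (C (C (ρ i)))
          (C (C (algebraMap k K α₁ * ρ i + algebraMap k K α₀))) (C X) Y := by
      rw [Polynomial.map_map, mapRingHom_comp, ← hcomp, ← mapRingHom_comp, ← Polynomial.map_map,
        hN, prodLNum, Polynomial.map_prod]
      refine Finset.prod_congr rfl fun i _ ↦ ?_
      rw [lineForm_map]
      simp
    rw [Polynomial.map_mul, hnum, Polynomial.map_C, coe_mapRingHom, Polynomial.map_C, map_inv₀, hDE]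

end Procedure

/-! ## The outcome of the procedure -/

section Outcome

lemma exists_roots_of_esymm {K : Type*} [Field K] [IsAlgClosed K] (e₁ e₂ e₃ : K) :
    ∃ ρ : Fin 3 → K, ρ 0 + ρ 1 + ρ 2 = e₁ ∧ ρ 0 * ρ 1 + ρ 0 * ρ 2 + ρ 1 * ρ 2 = e₂ ∧
      ρ 0 * ρ 1 * ρ 2 = e₃ := by
  let P : Cubic K := ⟨1, -e₁, e₂, -e₃⟩
  have ha : P.a ≠ 0 := one_ne_zero
  obtain ⟨x, y, z, h⟩ := (Cubic.splits_iff_roots_eq_three (φ := RingHom.id K) ha).mp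
    (IsAlgClosed.splits _)
  have hb := Cubic.b_eq_three_roots ha h
  have hc := Cubic.c_eq_three_roots ha h
  have hd := Cubic.d_eq_three_roots ha h
  simp only [P, RingHom.id_apply, one_mul, neg_inj] at hb hc hd
  exact ⟨![x, y, z], hb.symm, hc.symm, hd.symm⟩

variable {k : Type*} [Field k]

lemma c_eq_dblC (A B α₁ α₀ : k) : c A B α₁ α₀ = dblC A B α₁ α₀ := by
  simp only [c, dblC]
  ring

lemma u₁_eq_dblU₁ (A B α₁ α₀ : k) : u₁ A B α₁ α₀ = dblU₁ A B α₁ α₀ := by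
  simp only [u₁, dblU₁]
  ring

lemma u₀_eq_dblU₀ (A B α₁ α₀ : k) : u₀ A B α₁ α₀ = dblU₀ A B α₁ α₀ := by
  simp only [u₀, dblU₀]
  ring

/-- All coefficients of c are even. The slopes in the procedure have denominator 2y, so this is
needed to run it. -/
lemma two_ne_zero_of_c_ne_zero {A B α₁ α₀ : k} (hc : c A B α₁ α₀ ≠ 0) : (2 : k) ≠ 0 := by
  intro h
  apply hc
  simp only [c]
  linear_combination (4 * B * α₁ ^ 3 - 4 * A * α₁ ^ 2 * α₀ - 4 * α₀ ^ 3) * h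

/-- The commutative-ring polynomials entering the tripling identity commute with ring
homomorphisms. -/
lemma map_tripling_polys {R S : Type*} [CommRing R] [CommRing S] (φ : R →+* S) (A B α₁ α₀ : R) :
    φ (tripD A B α₁ α₀) = tripD (φ A) (φ B) (φ α₁) (φ α₀) ∧
    φ (tripV₁ A B α₁ α₀) = tripV₁ (φ A) (φ B) (φ α₁) (φ α₀) ∧
    φ (tripV₀ A B α₁ α₀) = tripV₀ (φ A) (φ B) (φ α₁) (φ α₀) ∧
    φ (dblC A B α₁ α₀) = dblC (φ A) (φ B) (φ α₁) (φ α₀) ∧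
    φ (dblU₁ A B α₁ α₀) = dblU₁ (φ A) (φ B) (φ α₁) (φ α₀) ∧
    φ (dblU₀ A B α₁ α₀) = dblU₀ (φ A) (φ B) (φ α₁) (φ α₀) := by
  simp only [tripD, tripV₁, tripV₀, dblC, dblU₁, dblU₀, map_add, map_sub, map_neg, map_mul,
    map_pow, map_ofNat, and_self]

lemma neg_flipY_linePoly (γ β₁ β₀ : k) :
    -flipY (linePoly γ β₁ β₀) = C (C γ) * Y + C (C β₁ * X + C β₀) := by
  simp only [flipY, linePoly, sub_comp, mul_comp, C_comp, X_comp]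
  ring

/-- Degree 1 in y is smaller than the degree 2 of the curve equation. This justifies dividing by
h_{-P} and h_{-2P}. -/
lemma toFun_line_ne_zero (A B : k) {γ : k} (hγ : γ ≠ 0) (β₁ β₀ : k) :
    toFun A B (C (C γ) * Y + C (C β₁ * X + C β₀)) ≠ 0 := by
  have hdeg : (C (C γ) * Y + C (C β₁ * X + C β₀) : k[X][Y]).natDegree = 1 :=
    natDegree_linear (C_ne_zero.mpr hγ)
  rw [toFun, ne_eq, map_eq_zero_iff _ (IsFractionRing.injective _ _)]
  refine AdjoinRoot.mk_ne_zero_of_natDegree_lt WeierstrassCurve.Affine.monic_polynomial ?_ ?_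
  · intro h
    rw [h, natDegree_zero] at hdeg
    exact zero_ne_one hdeg
  · rw [hdeg, WeierstrassCurve.Affine.natDegree_polynomial]
    exact one_lt_two

lemma curve_polynomial (A B : k) :
    (curve A B).polynomial = Y ^ 2 - C (X ^ 3 + C A * X + C B) := by
  simp [WeierstrassCurve.Affine.polynomial, curve]

lemma toFun_mul (A B : k) (f g : k[X][Y]) : toFun A B (f * g) = toFun A B f * toFun A B g := by
  simp [toFun]

/-- Over an algebraic closure, the procedure returns the product of the lines through the
intersection points `Pᵢ` of the line and the curve and their doubles. -/
lemma exists_isProcL_of_c_ne_zero {A B α₁ α₀ : k} (hc : c A B α₁ α₀ ≠ 0) :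
    ∃ (L : k[X][Y]) (ρ : Fin 3 → AlgebraicClosure k), IsProcL A B α₁ α₀ L ∧
      ρ 0 + ρ 1 + ρ 2 = algebraMap k _ (α₁ ^ 2) ∧
      ρ 0 * ρ 1 + ρ 0 * ρ 2 + ρ 1 * ρ 2 = algebraMap k _ (A - 2 * α₀ * α₁) ∧
      ρ 0 * ρ 1 * ρ 2 = algebraMap k _ (α₀ ^ 2 - B) ∧
      L.map (mapRingHom (algebraMap k (AlgebraicClosure k))) =
        C (C (algebraMap k _ (-(c A B α₁ α₀)⁻¹ ^ 3))) *
          ∏ i, lineForm (C (C (algebraMap k _ A))) (C (C (ρ i)))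
            (C (C (algebraMap k _ α₁ * ρ i + algebraMap k _ α₀))) (C X) Y := by
  obtain ⟨ρ, h₁, h₂, h₃⟩ := exists_roots_of_esymm (K := AlgebraicClosure k)
    (algebraMap k _ (α₁ ^ 2)) (algebraMap k _ (A - 2 * α₀ * α₁)) (algebraMap k _ (α₀ ^ 2 - B))
  have hprod := eight_mul_prod_y (A := algebraMap k (AlgebraicClosure k) A)
    (B := algebraMap k _ B) (α₁ := algebraMap k _ α₁) (α₀ := algebraMap k _ α₀)
    (by rw [h₁, map_pow]) (by rw [h₂]; simp [map_ofNat]) (by rw [h₃]; simp)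
  rw [← (map_tripling_polys (algebraMap k (AlgebraicClosure k)) A B α₁ α₀).2.2.2.1, ← c_eq_dblC]
    at hprod
  have hcK : algebraMap k (AlgebraicClosure k) (c A B α₁ α₀) ≠ 0 := (_root_.map_ne_zero _).mpr hc
  have hy : ∀ i, algebraMap k _ α₁ * ρ i + algebraMap k (AlgebraicClosure k) α₀ ≠ 0 := by
    intro i hi
    apply hcK
    rw [← neg_eq_zero, ← hprod]
    fin_cases i <;> simp only [Fin.zero_eta, Fin.mk_one, Fin.reduceFinMk] at hi <;> rw [hi] <;> ring
  obtain ⟨L, hL, hmap⟩ := exists_isProcL (two_ne_zero_of_c_ne_zero hc) h₁ h₂ h₃ hy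
  refine ⟨L, ρ, hL, h₁, h₂, h₃, ?_⟩
  rw [hmap]
  congr 3
  -- The product is (8 y₁y₂y₃)³ = (-c)³.
  have : ∏ i, (2 * (algebraMap k _ α₁ * ρ i + algebraMap k (AlgebraicClosure k) α₀)) ^ 3 =
      -algebraMap k _ (c A B α₁ α₀) ^ 3 := by
    rw [Finset.prod_pow, Fin.prod_univ_three, ← Odd.neg_pow (by decide), ← hprod]
    ring
  rw [this, map_neg, map_pow, map_inv₀, inv_neg, inv_pow]

lemma flipY_lineForm (A a b : k) :
    flipY (lineForm (C (C A)) (C (C a)) (C (C b)) (C X) Y) =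
      lineForm (C (C A)) (C (C a)) (C (C b)) (C X) (-Polynomial.X) := by
  simp [flipY, lineForm, slopeNum, psiNum]

lemma flipY_mul (f g : k[X][Y]) : flipY (f * g) = flipY f * flipY g :=
  mul_comp _ _ _

lemma flipY_C (f : k[X]) : flipY (C f : k[X][Y]) = C f :=
  C_comp

lemma flipY_map {K : Type*} [Field K] (ι : k →+* K) (f : k[X][Y]) :
    (flipY f).map (mapRingHom ι) = flipY (f.map (mapRingHom ι)) := by
  simp [flipY, Polynomial.map_comp]

/-- The product of the flipped lines, modulo the equation of the curve. -/
lemma polynomial_dvd_flipY_sub {K : Type*} [Field K] (ι : k →+* K) (h3 : (3 : k) ≠ 0)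
    {A B α₁ α₀ t : k} {L : k[X][Y]} {r₀ r₁ r₂ : K} (h₁ : r₀ + r₁ + r₂ = ι α₁ ^ 2)
    (h₂ : r₀ * r₁ + r₀ * r₂ + r₁ * r₂ = ι A - 2 * ι α₀ * ι α₁)
    (h₃ : r₀ * r₁ * r₂ = ι α₀ ^ 2 - ι B)
    (hL : L.map (mapRingHom ι) = C (C (ι t)) *
      (lineForm (C (C (ι A))) (C (C r₀)) (C (C (ι α₁ * r₀ + ι α₀))) (C X) Y *
        lineForm (C (C (ι A))) (C (C r₁)) (C (C (ι α₁ * r₁ + ι α₀))) (C X) Y *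
        lineForm (C (C (ι A))) (C (C r₂)) (C (C (ι α₁ * r₂ + ι α₀))) (C X) Y)) :
    (curve A B).polynomial ∣ flipY L -
      C (C (3 * t)) * linePoly (d A B α₁ α₀) (v₁ A B α₁ α₀) (v₀ A B α₁ α₀) *
        ((C (C 1) * Y + C (C α₁ * X + C α₀)) *
          (C (C (c A B α₁ α₀)) * Y + C (C (u₁ A B α₁ α₀) * X + C (u₀ A B α₁ α₀)))) := by
  -- Divisibility by a monic polynomial can be tested over the extension K, where the roots are
  -- available.
  rw [← map_dvd_map (mapRingHom ι) (Polynomial.map_injective ι ι.injective)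
    WeierstrassCurve.Affine.monic_polynomial]
  obtain ⟨w, hw⟩ := exists_prod_lineForm_eq (R := K[X][Y])
    (A := C (C (ι A))) (B := C (C (ι B))) (α₁ := C (C (ι α₁))) (α₀ := C (C (ι α₀)))
    (r₀ := C (C r₀)) (r₁ := C (C r₁)) (r₂ := C (C r₂))
    (by simpa using congrArg (fun t ↦ C (C t)) h₁)
    (by simpa [map_ofNat] using congrArg (fun t ↦ C (C t)) h₂)
    (by simpa using congrArg (fun t ↦ C (C t)) h₃) (C X) Y
  obtain ⟨hd, hv₁, hv₀, hcc, hu₁, hu₀⟩ :=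
    map_tripling_polys ((C.comp C).comp ι : k →+* K[X][Y]) A B α₁ α₀
  simp only [← three_mul_d h3, ← three_mul_v₁ h3, ← three_mul_v₀ h3, ← c_eq_dblC,
    ← u₁_eq_dblU₁, ← u₀_eq_dblU₀, RingHom.comp_apply] at hd hv₁ hv₀ hcc hu₁ hu₀
  simp only [← hd, ← hv₁, ← hv₀, ← hcc, ← hu₁, ← hu₀] at hw
  rw [Polynomial.map_sub, flipY_map, hL, flipY_mul, flipY_mul, flipY_mul, flipY_C, flipY_lineForm,
    flipY_lineForm, flipY_lineForm]
  simp only [map_add, map_mul] at hw ⊢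
  rw [hw, curve_polynomial]
  refine ⟨C (C (ι t)) * w, ?_⟩
  simp only [linePoly, Polynomial.map_mul, Polynomial.map_add, Polynomial.map_sub,
    Polynomial.map_pow, map_C, map_X, coe_mapRingHom, map_mul, map_add, map_pow,
    map_ofNat, map_one, Polynomial.map_ofNat, Polynomial.map_one]
  ring

/-- The flipped product of the lines, in terms of the doubling and tripling formulas. -/
lemma toFun_flipY_eq (h3 : (3 : k) ≠ 0) {A B α₁ α₀ : k} (hc : c A B α₁ α₀ ≠ 0)
    {L : k[X][Y]} (hL : IsProcL A B α₁ α₀ L) :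
    toFun A B (flipY L) = toFun A B
      (C (C (3 * -(c A B α₁ α₀)⁻¹ ^ 3)) *
          linePoly (d A B α₁ α₀) (v₁ A B α₁ α₀) (v₀ A B α₁ α₀) *
        ((C (C 1) * Y + C (C α₁ * X + C α₀)) *
          (C (C (c A B α₁ α₀)) * Y + C (C (u₁ A B α₁ α₀) * X + C (u₀ A B α₁ α₀))))) := by
  obtain ⟨L', ρ, hL', h₁, h₂, h₃, hmap⟩ := exists_isProcL_of_c_ne_zero hc
  -- By uniqueness, L is the polynomial computed from the roots.
  obtain rfl := IsSymmSubst.unique hL hL'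
  rw [toFun, toFun]
  congr 1
  rw [Fin.prod_univ_three] at hmap
  exact AdjoinRoot.mk_eq_mk.mpr (polynomial_dvd_flipY_sub (algebraMap k (AlgebraicClosure k)) h3
    (by rw [h₁, map_pow]) (by rw [h₂]; simp [map_ofNat]) (by rw [h₃]; simp) hmap)

/-- The procedure is well defined and yields the tripling formulas. -/
theorem procedure_correct (h3 : (3 : k) ≠ 0) {A B α₁ α₀ : k} (hc : c A B α₁ α₀ ≠ 0) :
    (∃! L : k[X][Y], IsProcL A B α₁ α₀ L) ∧ ∀ L : k[X][Y], IsProcL A B α₁ α₀ L →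
      ∃ t : k, t ≠ 0 ∧ recovered A B α₁ α₀ L =
        toFun A B (C (C t) * linePoly (d A B α₁ α₀) (v₁ A B α₁ α₀) (v₀ A B α₁ α₀)) := by
  refine ⟨?_, fun L hL ↦ ⟨3 * -(c A B α₁ α₀)⁻¹ ^ 3, ?_, ?_⟩⟩
  · obtain ⟨L, -, hL, -⟩ := exists_isProcL_of_c_ne_zero hc
    exact ⟨L, hL, fun L' hL' ↦ IsSymmSubst.unique hL' hL⟩
  · exact mul_ne_zero h3 (neg_ne_zero.mpr (pow_ne_zero _ (inv_ne_zero hc)))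
  · rw [recovered, toFun_flipY_eq h3 hc hL, neg_flipY_linePoly, neg_flipY_linePoly, toFun_mul,
      toFun_mul A B (_ + _)]
    exact mul_div_cancel_right₀ _
      (mul_ne_zero (toFun_line_ne_zero A B one_ne_zero _ _) (toFun_line_ne_zero A B hc _ _))

end Outcome

/-! ## Points of the curve -/

section Curve

open WeierstrassCurve.Affine

variable {F K : Type*} [Field F] [Field K] [Algebra F K] {A B : F}

lemma curve_negY (x y : K) :
    (WeierstrassCurve.Affine.baseChange (curve A B) K).negY x y = -y := by
  simp [negY, curve]

lemma curve_addX (x₁ x₂ l : K) :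
    (WeierstrassCurve.Affine.baseChange (curve A B) K).addX x₁ x₂ l = l ^ 2 - x₁ - x₂ := by
  simp [addX, curve]

lemma curve_equation_iff (x y : K) :
    (WeierstrassCurve.Affine.baseChange (curve A B) K).Equation x y ↔
      y ^ 2 = x ^ 3 + algebraMap F K A * x + algebraMap F K B := by
  simp [equation_iff, curve]

lemma curve_nonsingular_deriv {x : K}
    (h : (WeierstrassCurve.Affine.baseChange (curve A B) K).Nonsingular x 0) :
    3 * x ^ 2 + algebraMap F K A ≠ 0 := by
  rw [nonsingular_iff] at h
  simpa [curve, eq_comm] using h.2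

lemma map_cubic_sub (α₁ α₀ : F) :
    (cubic A B - (C α₁ * X + C α₀) ^ 2).map (algebraMap F K) =
      cubic (algebraMap F K A) (algebraMap F K B) -
        (C (algebraMap F K α₁) * X + C (algebraMap F K α₀)) ^ 2 := by
  simp [cubic]

/-- The elementary symmetric functions of the intersection points of a line and the curve. -/
lemma esymm_of_cubic_sub_eq_prod {a b l m : K} {x : Fin 3 → K}
    (h : cubic a b - (C l * X + C m) ^ 2 = ∏ i, (X - C (x i))) :
    x 0 + x 1 + x 2 = l ^ 2 ∧ x 0 * x 1 + x 0 * x 2 + x 1 * x 2 = a - 2 * m * l ∧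
      x 0 * x 1 * x 2 = m ^ 2 - b := by
  have h' : cubic a b - (C l * X + C m) ^ 2 =
      Cubic.toPoly ⟨1, -l ^ 2, a - 2 * m * l, -(m ^ 2 - b)⟩ := by
    simp only [cubic, Cubic.toPoly, map_sub, map_pow, map_mul, map_neg, map_ofNat, map_one]
    ring
  rw [h', Fin.prod_univ_three, Cubic.prod_X_sub_C_eq, Cubic.toPoly_injective] at h
  injection h with _ hb hc hd
  exact ⟨by linear_combination hb, hc.symm, by linear_combination hd⟩

/-- If all three intersection points of a line and the curve have `y = 0`, the line is `y = 0`. -/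
lemma line_eq_zero {l m : K} {x y : Fin 3 → K}
    (hns : ∀ i, (WeierstrassCurve.Affine.baseChange (curve A B) K).Nonsingular (x i) (y i))
    (hy : ∀ i, y i = l * x i + m) (hy0 : ∀ i, y i = 0)
    (h : cubic (algebraMap F K A) (algebraMap F K B) - (C l * X + C m) ^ 2 =
      ∏ i, (X - C (x i))) : l = 0 ∧ m = 0 := by
  have hl : l = 0 := by
    by_contra hl
    -- A non-horizontal line meets y = 0 once, so all abscissas agree and form a triple root.
    -- Differentiating there gives f'(x) = 0 together with y = 0, contradicting nonsingularity.
    have hx : ∀ i, x i = x 0 := fun i ↦ by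
      have h₀ := (hy 0).symm.trans (hy0 0)
      have hi := (hy i).symm.trans (hy0 i)
      exact mul_left_cancel₀ hl (by linear_combination hi - h₀)
    have hd := congrArg (fun p ↦ (derivative p).eval (x 0)) h
    have h0 := hns 0
    rw [hy0 0] at h0
    apply curve_nonsingular_deriv h0
    have h₀ := (hy 0).symm.trans (hy0 0)
    rw [Fin.prod_univ_three, hx 1, hx 2] at hd
    simp [cubic, derivative_pow, h₀] at hd
    linear_combination hd
  refine ⟨hl, ?_⟩
  have h₀ := (hy 0).symm.trans (hy0 0)
  rwa [hl, zero_mul, zero_add] at h₀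

/-- The line through the intersection points is determined by them. -/
lemma line_unique (h2 : (2 : K) ≠ 0) {l m l' m' : K} {x y : Fin 3 → K}
    (hns : ∀ i, (WeierstrassCurve.Affine.baseChange (curve A B) K).Nonsingular (x i) (y i))
    (hy : ∀ i, y i = l * x i + m) (hy' : ∀ i, y i = l' * x i + m')
    (h : cubic (algebraMap F K A) (algebraMap F K B) - (C l * X + C m) ^ 2 =
      ∏ i, (X - C (x i)))
    (h' : cubic (algebraMap F K A) (algebraMap F K B) - (C l' * X + C m') ^ 2 =
      ∏ i, (X - C (x i))) : l = l' ∧ m = m' := by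
  -- Both squares equal f minus the same product, so the two linear forms agree up to sign.
  have hsq : (C l * X + C m) ^ 2 = (C l' * X + C m') ^ 2 := by
    linear_combination h' - h
  have hcoeff : ∀ {l m l' m' : K}, C l * X + C m = C l' * X + C m' → l = l' ∧ m = m' := by
    intro l m l' m' e
    exact ⟨by simpa using congrArg (coeff · 1) e, by simpa using congrArg (coeff · 0) e⟩
  rcases sq_eq_sq_iff_eq_or_eq_neg.mp hsq with e | e
  · exact hcoeff e
  · have e' : C l * X + C m = C (-l') * X + C (-m') := by
      rw [e, C_neg, C_neg]
      ring
    obtain ⟨rfl, rfl⟩ := hcoeff e'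
    -- Opposite lines through the same points force 2yᵢ = 0, and then the line is y = 0, equal to
    -- its opposite.
    have hy0 : ∀ i, y i = 0 := fun i ↦ by
      have := hy i
      have := hy' i
      have : 2 * y i = 0 := by linear_combination hy i + hy' i
      exact (mul_eq_zero.mp this).resolve_left h2
    obtain ⟨hl, hm⟩ := line_eq_zero hns hy' hy0 h'
    simp [hl, hm]

/-- Three points with sum zero lie on a line, which cuts out exactly these points. -/
lemma exists_line_of_add_eq_zero [DecidableEq K] {x y : Fin 3 → K}
    (hns : ∀ i, (WeierstrassCurve.Affine.baseChange (curve A B) K).Nonsingular (x i) (y i))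
    (hsum : Point.some (x 0) (y 0) (hns 0) + Point.some (x 1) (y 1) (hns 1) +
      Point.some (x 2) (y 2) (hns 2) = 0) :
    ∃ l m : K, (∀ i, y i = l * x i + m) ∧
      cubic (algebraMap F K A) (algebraMap F K B) - (C l * X + C m) ^ 2 = ∏ i, (X - C (x i)) := by
  -- Otherwise the first two points are opposite and the third would be the point at infinity.
  have hxy : ¬(x 0 = x 1 ∧
      y 0 = (WeierstrassCurve.Affine.baseChange (curve A B) K).negY (x 1) (y 1)) := by
    rintro ⟨hx, hy⟩
    rw [Point.add_of_Y_eq hx hy, zero_add] at hsum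
    exact Point.some_ne_zero _ hsum
  rw [Point.add_some hxy, add_eq_zero_iff_eq_neg, Point.neg_some, Point.some.injEq] at hsum
  obtain ⟨hX, hY⟩ := hsum
  have hpoly := addPolynomial_slope (hns 0).1 (hns 1).1 hxy
  set l := (WeierstrassCurve.Affine.baseChange (curve A B) K).slope (x 0) (x 1) (y 0) (y 1)
    with hl
  rw [addY, hX, curve_negY, curve_negY, neg_inj, negAddY, hX] at hY
  refine ⟨l, y 0 - l * x 0, ?_, ?_⟩
  · intro i
    fin_cases i
    · simp
    · rcases eq_or_ne (x 0) (x 1) with hx | hx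
      · have hy : y 0 ≠ (WeierstrassCurve.Affine.baseChange (curve A B) K).negY (x 1) (y 1) :=
          fun h ↦ hxy ⟨hx, h⟩
        have := Y_eq_of_Y_ne (hns 0).1 (hns 1).1 hx hy
        simp [← hx, ← this]
      · have : l * (x 0 - x 1) = y 0 - y 1 := by
          rw [hl, slope_of_X_ne hx, div_mul_cancel₀ _ (sub_ne_zero.mpr hx)]
        simp only [Fin.mk_one]
        linear_combination this
    · simp only [Fin.reduceFinMk]
      linear_combination -hY
  · rw [hX, addPolynomial_eq] at hpoly
    rw [Fin.prod_univ_three, ← neg_inj, ← hpoly, Cubic.toPoly]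
    have := (curve_equation_iff _ _).mp (hns 0).1
    simp [curve, cubic, map_ofNat]
    ring

end Curve

/-! ## The Frobenius conjugates of a point of trace zero -/

section Frobenius

open WeierstrassCurve.Affine

variable {F K : Type*} [Field F] [Fintype F] [Field K] [Algebra F K] {A B : F}

lemma frobeniusAlgHom_iterate_three (hK : Module.finrank F K = 3) (x : K) :
    FiniteField.frobeniusAlgHom F K (FiniteField.frobeniusAlgHom F K
      (FiniteField.frobeniusAlgHom F K x)) = x := by
  have : FiniteDimensional F K := Module.finite_of_finrank_pos (by omega)
  have : Finite K := Module.finite_of_finite F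
  have h := pow_orderOf_eq_one (FiniteField.frobeniusAlgHom F K)
  rw [FiniteField.orderOf_frobeniusAlgHom, hK] at h
  exact DFunLike.congr_fun h x

/-- Frobenius generates the Galois group, so an element fixed by it is fixed by the whole group. -/
lemma exists_algebraMap_eq_of_frobenius_eq (hK : Module.finrank F K = 3) {x : K}
    (hx : FiniteField.frobeniusAlgHom F K x = x) : ∃ a : F, algebraMap F K a = x := by
  have : FiniteDimensional F K := Module.finite_of_finrank_pos (by omega)
  have : Finite K := Module.finite_of_finite F
  have hmem : x ∈ (⊥ : IntermediateField F K) := by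
    rw [IsGalois.mem_bot_iff_fixed]
    intro g
    obtain ⟨n, rfl⟩ := (FiniteField.bijective_frobeniusAlgEquivOfAlgebraic_pow F K).2 g
    have : ∀ m : ℕ, (FiniteField.frobeniusAlgEquivOfAlgebraic F K ^ m) x = x := by
      intro m
      induction m with
      | zero => rfl
      | succ m ih =>
        rw [pow_succ, AlgEquiv.mul_apply]
        exact (congrArg _ hx).trans ih
    exact this n
  exact IntermediateField.mem_bot.mp hmem

variable [DecidableEq K]

lemma frob_some {x y : K} (h : (WeierstrassCurve.Affine.baseChange (curve A B) K).Nonsingular x y) :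
    ∃ h', frob K A B (.some x y h) = .some (FiniteField.frobeniusAlgHom F K x)
      (FiniteField.frobeniusAlgHom F K y) h' :=
  ⟨_, rfl⟩

lemma frob_injective : Function.Injective (frob K A B) :=
  Point.map_injective _

lemma exists_conj_coords {P : Points K A B} (hP : P ≠ 0) :
    ∃ (x y : Fin 3 → K)
      (h : ∀ i, (WeierstrassCurve.Affine.baseChange (curve A B) K).Nonsingular (x i) (y i)),
      ∀ i : Fin 3, (frob K A B)^[(i : ℕ)] P = .some (x i) (y i) (h i) := by
  have : ∀ n : ℕ, ∃ (x y : K)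
      (h : (WeierstrassCurve.Affine.baseChange (curve A B) K).Nonsingular x y),
      (frob K A B)^[n] P = .some x y h := by
    intro n
    have hn : (frob K A B)^[n] P ≠ 0 := by
      rw [← iterate_map_zero (frob K A B) n]
      exact fun h ↦ hP ((frob_injective.iterate n) h)
    generalize (frob K A B)^[n] P = Q at hn
    match Q, hn with
    | 0, hn => exact absurd rfl hn
    | .some x y h, _ => exact ⟨x, y, h, rfl⟩
  choose x y h hh using this
  exact ⟨fun i ↦ x i, fun i ↦ y i, fun i ↦ h i, fun i ↦ hh i⟩

lemma frobenius_conj_coords (hK : Module.finrank F K = 3) {P : Points K A B} {x y : Fin 3 → K}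
    {h : ∀ i, (WeierstrassCurve.Affine.baseChange (curve A B) K).Nonsingular (x i) (y i)}
    (hP : ∀ i : Fin 3, (frob K A B)^[(i : ℕ)] P = .some (x i) (y i) (h i)) (i : Fin 3) :
    FiniteField.frobeniusAlgHom F K (x i) = x (i + 1) ∧
      FiniteField.frobeniusAlgHom F K (y i) = y (i + 1) := by
  have h0 := hP 0
  have h1 := hP 1
  have h2 := hP 2
  simp only [Fin.val_zero, Fin.val_one, Fin.val_two, Function.iterate_succ, Function.iterate_zero,
    Function.comp_apply, id_eq] at h0 h1 h2
  rw [h0] at h1 h2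
  obtain ⟨h', e⟩ := frob_some (h 0)
  rw [e] at h1 h2
  obtain ⟨h'', e'⟩ := frob_some h'
  rw [e'] at h2
  rw [Point.some.injEq] at h1 h2
  have hx₁ : FiniteField.frobeniusAlgHom F K (x 1) = x 2 := by rw [← h1.1, h2.1]
  have hy₁ : FiniteField.frobeniusAlgHom F K (y 1) = y 2 := by rw [← h1.2, h2.2]
  have hx₂ : FiniteField.frobeniusAlgHom F K (x 2) = x 0 := by
    rw [← h2.1, frobeniusAlgHom_iterate_three hK]
  have hy₂ : FiniteField.frobeniusAlgHom F K (y 2) = y 0 := by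
    rw [← h2.2, frobeniusAlgHom_iterate_three hK]
  fin_cases i
  exacts [h1, ⟨hx₁, hy₁⟩, ⟨hx₂, hy₂⟩]

lemma conj_sum_eq_zero {P : Points K A B} (hT : P ∈ T₃ K A B) :
    (frob K A B)^[0] P + (frob K A B)^[1] P + (frob K A B)^[2] P = 0 :=
  hT

lemma isConjLine_iff {P : Points K A B} {x y : Fin 3 → K}
    {h : ∀ i, (WeierstrassCurve.Affine.baseChange (curve A B) K).Nonsingular (x i) (y i)}
    (hP : ∀ i : Fin 3, (frob K A B)^[(i : ℕ)] P = .some (x i) (y i) (h i)) (α₁ α₀ : F) :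
    IsConjLine P α₁ α₀ ↔ (∀ i, y i = algebraMap F K α₁ * x i + algebraMap F K α₀) ∧
      cubic (algebraMap F K A) (algebraMap F K B) -
        (C (algebraMap F K α₁) * X + C (algebraMap F K α₀)) ^ 2 = ∏ i, (X - C (x i)) := by
  rw [← map_cubic_sub]
  constructor
  · rintro ⟨x', y', h', hP', hy, hp⟩
    have e : ∀ i, x' i = x i ∧ y' i = y i := fun i ↦ by
      have := (hP' i).symm.trans (hP i)
      rwa [Point.some.injEq] at this
    obtain rfl : x' = x := funext fun i ↦ (e i).1
    obtain rfl : y' = y := funext fun i ↦ (e i).2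
    exact ⟨hy, hp⟩
  · rintro ⟨hy, hp⟩
    exact ⟨x, y, h, hP, hy, hp⟩

lemma IsConjLine.unique (h2 : (2 : K) ≠ 0) {P : Points K A B} {α₁ α₀ β₁ β₀ : F}
    (hα : IsConjLine P α₁ α₀) (hβ : IsConjLine P β₁ β₀) : α₁ = β₁ ∧ α₀ = β₀ := by
  obtain ⟨x, y, h, hP, hy, hp⟩ := hα
  obtain ⟨hy', hp'⟩ := (isConjLine_iff hP _ _).mp hβ
  rw [map_cubic_sub] at hp
  obtain ⟨e, e'⟩ := line_unique h2 h hy hy' hp hp'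
  exact ⟨(algebraMap F K).injective e, (algebraMap F K).injective e'⟩

/-- The line through the Frobenius conjugates exists, is unique and is defined over `F`. -/
lemma existsUnique_isConjLine (hK : Module.finrank F K = 3) (h2 : (2 : K) ≠ 0)
    {P : Points K A B} (hT : P ∈ T₃ K A B) (hP0 : P ≠ 0) :
    ∃! α : F × F, IsConjLine P α.1 α.2 := by
  obtain ⟨x, y, h, hP⟩ := exists_conj_coords hP0
  have hsum := conj_sum_eq_zero hT
  have h0 := hP 0
  have h1 := hP 1
  have h2' := hP 2
  simp only [Fin.val_zero, Fin.val_one, Fin.val_two] at h0 h1 h2'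
  rw [h0, h1, h2'] at hsum
  obtain ⟨l, m, hy, hp⟩ := exists_line_of_add_eq_zero h hsum
  have hφ := frobenius_conj_coords hK hP
  set φ := FiniteField.frobeniusAlgHom F K with hφdef
  -- Frobenius shifts the three points cyclically, so the conjugate line passes through the same
  -- points and, by `hp'`, cuts out the same triple.
  have hy' : ∀ i, y i = φ l * x i + φ m := by
    intro i
    have e := congrArg φ (hy (i - 1))
    rwa [map_add, map_mul, (hφ _).1, (hφ _).2, sub_add_cancel] at e
  have hp' : cubic (algebraMap F K A) (algebraMap F K B) - (C (φ l) * X + C (φ m)) ^ 2 =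
      ∏ i, (X - C (x i)) := by
    have e := congrArg (Polynomial.map (φ : K →+* K)) hp
    rw [Polynomial.map_prod, ← Equiv.prod_comp (Equiv.subRight (1 : Fin 3))] at e
    simpa [cubic, (hφ _).1] using e
  obtain ⟨hl, hm⟩ := line_unique h2 h hy' hy hp' hp
  obtain ⟨α₁, rfl⟩ := exists_algebraMap_eq_of_frobenius_eq hK hl
  obtain ⟨α₀, rfl⟩ := exists_algebraMap_eq_of_frobenius_eq hK hm
  have hα := (isConjLine_iff hP α₁ α₀).mpr ⟨hy, hp⟩
  exact ⟨(α₁, α₀), hα, fun β hβ ↦ Prod.ext (hβ.unique h2 hα).1 (hβ.unique h2 hα).2⟩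

end Frobenius

/-! ## The tripling formulas -/

section TriplingLine

/-- The norm of the identity for the product of the lines. -/
lemma tripling_norm_mul_eq_zero {R : Type*} [CommRing R] {A B α₁ α₀ r₀ r₁ r₂ x y : R}
    (h₁ : r₀ + r₁ + r₂ = α₁ ^ 2) (h₂ : r₀ * r₁ + r₀ * r₂ + r₁ * r₂ = A - 2 * α₀ * α₁)
    (h₃ : r₀ * r₁ * r₂ = α₀ ^ 2 - B) (hC : y ^ 2 = x ^ 3 + A * x + B)
    {y₀ y₁ y₂ : R} (hy₀ : y₀ = α₁ * r₀ + α₀) (hy₁ : y₁ = α₁ * r₁ + α₀) (hy₂ : y₂ = α₁ * r₂ + α₀) :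
    ((x - r₀) * (x - r₁) * (x - r₂)) *
      ((4 * y₀ ^ 2 * (x - r₀) + psiNum A r₀ y₀) * (4 * y₁ ^ 2 * (x - r₁) + psiNum A r₁ y₁) *
        (4 * y₂ ^ 2 * (x - r₂) + psiNum A r₂ y₂)) *
      ((psiNum A r₀ y₀ ^ 2 * (x - r₀) + 8 * y₀ ^ 2 * (slopeNum A r₀ y₀ + 8 * y₀ ^ 4)) *
        (psiNum A r₁ y₁ ^ 2 * (x - r₁) + 8 * y₁ ^ 2 * (slopeNum A r₁ y₁ + 8 * y₁ ^ 4)) *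
        (psiNum A r₂ y₂ ^ 2 * (x - r₂) + 8 * y₂ ^ 2 * (slopeNum A r₂ y₂ + 8 * y₂ ^ 4)) -
        (tripD A B α₁ α₀ ^ 2 * (x ^ 3 + A * x + B) -
          (tripV₁ A B α₁ α₀ * x + tripV₀ A B α₁ α₀) ^ 2)) = 0 := by
  have hc : ∀ r : R, (r - r₀) * (r - r₁) * (r - r₂) = 0 →
      (α₁ * r + α₀) ^ 2 = r ^ 3 + A * r + B := by
    intro r hr
    linear_combination -hr - r ^ 2 * h₁ + r * h₂ - h₃
  have hz : (x - r₀) * (x - r₁) * (x - r₂) = y ^ 2 - (α₁ * x + α₀) ^ 2 := by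
    linear_combination -(x ^ 2) * h₁ + x * h₂ - h₃ - hC
  have hd := prod_dblNum h₁ h₂ h₃ x
  -- The identity is used at y and at -y: the product of the two is the norm from the function field
  -- down to functions of x. Both correction terms vanish because (x, y) is on the curve.
  obtain ⟨w, hw⟩ := exists_prod_lineForm_eq h₁ h₂ h₃ x y
  obtain ⟨w', hw'⟩ := exists_prod_lineForm_eq h₁ h₂ h₃ x (-y)
  rw [neg_sq] at hw'
  rw [neg_neg] at hw'
  have n₀ := lineForm_mul_lineForm_neg (hc r₀ (by ring)) hC
  have n₁ := lineForm_mul_lineForm_neg (hc r₁ (by ring)) hC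
  have n₂ := lineForm_mul_lineForm_neg (hc r₂ (by ring)) hC
  rw [← hC] at hw hw' hd ⊢
  rw [sub_self, mul_zero, add_zero] at hw hw'
  rw [← hy₀] at n₀ hw hw' hd
  rw [← hy₁] at n₁ hw hw' hd
  rw [← hy₂] at n₂ hw hw' hd
  rw [mul_sub, hz, hd]
  have key : (y ^ 2 - (α₁ * x + α₀) ^ 2) * (dblC A B α₁ α₀ ^ 2 * y ^ 2 -
        (dblU₁ A B α₁ α₀ * x + dblU₀ A B α₁ α₀) ^ 2) *
      ((psiNum A r₀ y₀ ^ 2 * (x - r₀) + 8 * y₀ ^ 2 * (slopeNum A r₀ y₀ + 8 * y₀ ^ 4)) *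
        (psiNum A r₁ y₁ ^ 2 * (x - r₁) + 8 * y₁ ^ 2 * (slopeNum A r₁ y₁ + 8 * y₁ ^ 4)) *
        (psiNum A r₂ y₂ ^ 2 * (x - r₂) + 8 * y₂ ^ 2 * (slopeNum A r₂ y₂ + 8 * y₂ ^ 4))) =
      -((lineForm A r₀ y₀ x y * lineForm A r₁ y₁ x y * lineForm A r₂ y₂ x y) *
        (lineForm A r₀ y₀ x (-y) * lineForm A r₁ y₁ x (-y) * lineForm A r₂ y₂ x (-y))) := by
    have : ∀ a b c a' b' c' : R, a * b * c * (a' * b' * c') = (a * a') * (b * b') * (c * c') :=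
      fun _ _ _ _ _ _ ↦ by ring
    have this' : ∀ a b c a' b' c' a'' b'' c'' : R, a * b * c * (a' * b' * c') * (a'' * b'' * c'') =
        -(-(a * a' * a'') * -(b * b' * b'') * -(c * c' * c'')) :=
      fun _ _ _ _ _ _ _ _ _ ↦ by ring
    rw [this, n₀, n₁, n₂, ← hd, ← hz]
    exact this' _ _ _ _ _ _ _ _ _
  rw [key, hw, hw']
  generalize α₁ * x + α₀ = a
  generalize tripV₁ A B α₁ α₀ * x + tripV₀ A B α₁ α₀ = V
  generalize dblU₁ A B α₁ α₀ * x + dblU₀ A B α₁ α₀ = U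
  ring

variable {K : Type*} [Field K]

lemma map_psiNum {R S : Type*} [CommRing R] [CommRing S] (φ : R →+* S) (A a b : R) :
    φ (psiNum A a b) = psiNum (φ A) (φ a) (φ b) := by
  simp [psiNum, map_ofNat]

lemma map_slopeNum {R S : Type*} [CommRing R] [CommRing S] (φ : R →+* S) (A a b : R) :
    φ (slopeNum A a b) = slopeNum (φ A) (φ a) (φ b) := by
  simp [slopeNum, psiNum, map_ofNat]

/-- The abscissa of `3P`. -/
def tripleX (A x y : K) : K :=
  x - 8 * y ^ 2 * (slopeNum A x y + 8 * y ^ 4) / psiNum A x y ^ 2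

/-- The ordinate of `3P`. -/
def tripleY (A x y : K) : K :=
  -(y + 4 * y * slopeNum A x y * (slopeNum A x y + 8 * y ^ 4) / psiNum A x y ^ 3)

/-- The coordinate ring is an extension of `K[X]` in which the cubic is a square. -/
lemma exists_sq_eq_cubic (A B : K) :
    ∃ s : (curve A B).CoordinateRing,
      s ^ 2 = AdjoinRoot.of _ X ^ 3 + AdjoinRoot.of _ (C A) * AdjoinRoot.of _ X +
        AdjoinRoot.of _ (C B) := by
  refine ⟨AdjoinRoot.mk _ Y, ?_⟩
  change _ = AdjoinRoot.mk _ (C X) ^ 3 + AdjoinRoot.mk _ (C (C A)) * AdjoinRoot.mk _ (C X) +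
    AdjoinRoot.mk _ (C (C B))
  rw [← map_pow, ← map_pow, ← map_mul, ← map_add, ← map_add]
  refine AdjoinRoot.mk_eq_mk.mpr ⟨1, ?_⟩
  rw [curve_polynomial, mul_one]
  simp

/-- The line given by the tripling formulas cuts out the points `3Pᵢ`. -/
lemma cubic_sub_tripling_line_of_sq {R : Type*} [CommRing R] (ι : K[X] →+* R)
    (hι : Function.Injective ι) {A B α₁ α₀ : K} {s : R}
    (hC : s ^ 2 = ι X ^ 3 + ι (C A) * ι X + ι (C B)) {r y : Fin 3 → K}
    (h : cubic A B - (C α₁ * X + C α₀) ^ 2 = ∏ i, (X - C (r i)))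
    (hy : ∀ i, y i = α₁ * r i + α₀) (hψ : ∀ i, psiNum A (r i) (y i) ≠ 0) :
    cubic A B - (C (tripV₁ A B α₁ α₀ / tripD A B α₁ α₀) * X +
        C (tripV₀ A B α₁ α₀ / tripD A B α₁ α₀)) ^ 2 =
      ∏ i, (X - C (tripleX A (r i) (y i))) := by
  obtain ⟨h₁, h₂, h₃⟩ := esymm_of_cubic_sub_eq_prod h
  have hD : psiNum A (r 0) (y 0) * psiNum A (r 1) (y 1) * psiNum A (r 2) (y 2) =
      tripD A B α₁ α₀ := by
    rw [hy 0, hy 1, hy 2]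
    exact prod_psiNum h₁ h₂ h₃
  have hD0 : tripD A B α₁ α₀ ≠ 0 := by
    rw [← hD]
    exact mul_ne_zero (mul_ne_zero (hψ 0) (hψ 1)) (hψ 2)
  have hpoly := tripling_norm_mul_eq_zero (A := ι (C A)) (B := ι (C B)) (α₁ := ι (C α₁))
    (α₀ := ι (C α₀)) (r₀ := ι (C (r 0))) (r₁ := ι (C (r 1))) (r₂ := ι (C (r 2)))
    (y₀ := ι (C (y 0))) (y₁ := ι (C (y 1))) (y₂ := ι (C (y 2)))
    (by simpa only [map_add, map_pow] using congrArg (fun p ↦ ι (C p)) h₁)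
    (by simpa only [map_add, map_sub, map_mul, map_ofNat] using congrArg (fun p ↦ ι (C p)) h₂)
    (by simpa only [map_sub, map_mul, map_pow] using congrArg (fun p ↦ ι (C p)) h₃) hC
    (by simpa only [map_add, map_mul] using congrArg (fun p ↦ ι (C p)) (hy 0))
    (by simpa only [map_add, map_mul] using congrArg (fun p ↦ ι (C p)) (hy 1))
    (by simpa only [map_add, map_mul] using congrArg (fun p ↦ ι (C p)) (hy 2))
  obtain ⟨hd, hv₁, hv₀, -⟩ := map_tripling_polys (ι.comp C) A B α₁ α₀
  simp only [RingHom.comp_apply] at hd hv₁ hv₀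
  have hψC : ∀ i, psiNum (ι (C A)) (ι (C (r i))) (ι (C (y i))) = ι (C (psiNum A (r i) (y i))) :=
    fun i ↦ by rw [map_psiNum C, map_psiNum ι]
  have hmC : ∀ i, slopeNum (ι (C A)) (ι (C (r i))) (ι (C (y i))) =
      ι (C (slopeNum A (r i) (y i))) := fun i ↦ by rw [map_slopeNum C, map_slopeNum ι]
  rw [hψC, hψC, hψC, hmC, hmC, hmC, ← hd, ← hv₁, ← hv₀] at hpoly
  generalize tripD A B α₁ α₀ = D at *
  generalize tripV₁ A B α₁ α₀ = V₁ at *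
  generalize tripV₀ A B α₁ α₀ = V₀ at *
  have htrip : ∀ i, C (psiNum A (r i) (y i)) ^ 2 * (X - C (r i)) +
      8 * C (y i) ^ 2 * (C (slopeNum A (r i) (y i)) + 8 * C (y i) ^ 4) =
      C (psiNum A (r i) (y i)) ^ 2 * (X - C (tripleX A (r i) (y i))) := by
    intro i
    have : psiNum A (r i) (y i) ^ 2 * (r i - tripleX A (r i) (y i)) =
        8 * y i ^ 2 * (slopeNum A (r i) (y i) + 8 * y i ^ 4) := by
      rw [tripleX, sub_sub_cancel, mul_div_cancel₀ _ (pow_ne_zero 2 (hψ i))]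
    have e := congrArg (C : K → K[X]) this
    simp only [map_mul, map_sub, map_pow, map_add, map_ofNat] at e
    linear_combination -e
  -- Injectivity of ι moves the identity into the domain K[X], where the nonzero factors belonging
  -- to the Pᵢ and 2Pᵢ can be cancelled.
  have hfac := hι (a₁ := ((X - C (r 0)) * (X - C (r 1)) * (X - C (r 2))) *
      ((4 * C (y 0) ^ 2 * (X - C (r 0)) + C (psiNum A (r 0) (y 0))) *
        (4 * C (y 1) ^ 2 * (X - C (r 1)) + C (psiNum A (r 1) (y 1))) *
        (4 * C (y 2) ^ 2 * (X - C (r 2)) + C (psiNum A (r 2) (y 2)))) *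
      ((C (psiNum A (r 0) (y 0)) ^ 2 * (X - C (r 0)) +
          8 * C (y 0) ^ 2 * (C (slopeNum A (r 0) (y 0)) + 8 * C (y 0) ^ 4)) *
        (C (psiNum A (r 1) (y 1)) ^ 2 * (X - C (r 1)) +
          8 * C (y 1) ^ 2 * (C (slopeNum A (r 1) (y 1)) + 8 * C (y 1) ^ 4)) *
        (C (psiNum A (r 2) (y 2)) ^ 2 * (X - C (r 2)) +
          8 * C (y 2) ^ 2 * (C (slopeNum A (r 2) (y 2)) + 8 * C (y 2) ^ 4)) -
        (C D ^ 2 * (X ^ 3 + C A * X + C B) - (C V₁ * X + C V₀) ^ 2))) (a₂ := 0) (by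
    simp only [map_mul, map_add, map_sub, map_pow, map_ofNat, map_zero]
    exact hpoly)
  rw [htrip, htrip, htrip] at hfac
  have hdbl : ∀ i, 4 * C (y i) ^ 2 * (X - C (r i)) + C (psiNum A (r i) (y i)) ≠ 0 := by
    intro i e
    apply hψ i
    simpa using congrArg (eval (r i)) e
  have h0 := (mul_eq_zero.mp hfac).resolve_left (mul_ne_zero
    (mul_ne_zero (mul_ne_zero (X_sub_C_ne_zero _) (X_sub_C_ne_zero _)) (X_sub_C_ne_zero _))
    (mul_ne_zero (mul_ne_zero (hdbl 0) (hdbl 1)) (hdbl 2)))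
  have hDC : C (psiNum A (r 0) (y 0)) * C (psiNum A (r 1) (y 1)) * C (psiNum A (r 2) (y 2)) =
      C D := by
    rw [← hD, C_mul, C_mul]
  have hV : ∀ V : K, C D * C (V / D) = C V := fun V ↦ by
    rw [← C_mul, mul_div_cancel₀ _ hD0]
  refine mul_left_cancel₀ (pow_ne_zero 2 (C_ne_zero.mpr hD0)) ?_
  rw [Fin.prod_univ_three, cubic]
  have e₁ : C D ^ 2 * (X ^ 3 + C A * X + C B - (C (V₁ / D) * X + C (V₀ / D)) ^ 2) =
      C D ^ 2 * (X ^ 3 + C A * X + C B) - (C V₁ * X + C V₀) ^ 2 := by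
    rw [← hV V₁, ← hV V₀]
    ring
  rw [e₁, ← sub_eq_zero.mp h0, ← hDC]
  ring

/-- The norm argument needs a square root of f over the generic abscissa X; the function y in the
coordinate ring provides one. -/
lemma cubic_sub_tripling_line {A B α₁ α₀ : K} {r y : Fin 3 → K}
    (h : cubic A B - (C α₁ * X + C α₀) ^ 2 = ∏ i, (X - C (r i)))
    (hy : ∀ i, y i = α₁ * r i + α₀) (hψ : ∀ i, psiNum A (r i) (y i) ≠ 0) :
    cubic A B - (C (tripV₁ A B α₁ α₀ / tripD A B α₁ α₀) * X +
        C (tripV₀ A B α₁ α₀ / tripD A B α₁ α₀)) ^ 2 =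
      ∏ i, (X - C (tripleX A (r i) (y i))) := by
  obtain ⟨s, hs⟩ := exists_sq_eq_cubic A B
  refine cubic_sub_tripling_line_of_sq (AdjoinRoot.of (curve A B).polynomial) ?_ hs h hy hψ
  refine AdjoinRoot.of.injective_of_degree_ne_zero ?_
  rw [WeierstrassCurve.Affine.degree_polynomial]
  exact two_ne_zero

end TriplingLine

/-! ## Triples of points -/

section Triple

open WeierstrassCurve.Affine

variable {F K : Type*} [Field F] [Field K] [Algebra F K] [DecidableEq K] {A B : F}

lemma two_nsmul_some_of_y_eq_zero {x y : K}
    (h : (WeierstrassCurve.Affine.baseChange (curve A B) K).Nonsingular x y) (hy : y = 0) :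
    2 • (Point.some x y h : Points K A B) = 0 := by
  subst hy
  rw [two_nsmul]
  exact Point.add_self_of_Y_eq (by rw [curve_negY, neg_zero])

/-- The coordinates of `2P`. -/
lemma some_add_self (h2 : (2 : K) ≠ 0) {x y : K}
    (h : (WeierstrassCurve.Affine.baseChange (curve A B) K).Nonsingular x y) (hy : y ≠ 0) :
    ∃ h', (Point.some x y h + Point.some x y h : Points K A B) =
      .some (x - psiNum (algebraMap F K A) x y / (4 * y ^ 2))
        ((slopeNum (algebraMap F K A) x y + 8 * y ^ 4) / (8 * y ^ 3)) h' := by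
  have h4 : (4 : K) ≠ 0 := by
    have : (4 : K) = 2 ^ 2 := by norm_num
    rw [this]
    exact pow_ne_zero 2 h2
  have h8 : (8 : K) ≠ 0 := by
    have : (8 : K) = 2 ^ 3 := by norm_num
    rw [this]
    exact pow_ne_zero 3 h2
  have hneg : y ≠ (WeierstrassCurve.Affine.baseChange (curve A B) K).negY x y := by
    rw [curve_negY]
    intro e
    exact hy ((mul_eq_zero.mp (show 2 * y = 0 by linear_combination e)).resolve_left h2)
  have hslope : (WeierstrassCurve.Affine.baseChange (curve A B) K).slope x x y y =
      (3 * x ^ 2 + algebraMap F K A) / (2 * y) := by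
    rw [slope_of_Y_ne rfl hneg, curve_negY, sub_neg_eq_add, two_mul y]
    simp [curve]
  have hX : (WeierstrassCurve.Affine.baseChange (curve A B) K).addX x x
      ((WeierstrassCurve.Affine.baseChange (curve A B) K).slope x x y y) =
        x - psiNum (algebraMap F K A) x y / (4 * y ^ 2) := by
    rw [hslope, curve_addX, psiNum]
    field_simp
    ring
  have hY : (WeierstrassCurve.Affine.baseChange (curve A B) K).addY x x y
      ((WeierstrassCurve.Affine.baseChange (curve A B) K).slope x x y y) =
        (slopeNum (algebraMap F K A) x y + 8 * y ^ 4) / (8 * y ^ 3) := by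
    rw [addY, curve_negY, negAddY, hX, hslope, slopeNum]
    generalize psiNum (algebraMap F K A) x y = ψ
    field_simp
    ring
  refine ⟨hX ▸ hY ▸ nonsingular_add h h fun hxy ↦ hneg hxy.2, ?_⟩
  rw [Point.add_self_of_Y_ne hneg, Point.some.injEq]
  exact ⟨hX, hY⟩

/-- The third division polynomial does not vanish at a point `P` with `3P ≠ 0`. -/
lemma psiNum_ne_zero (h2 : (2 : K) ≠ 0) {x y : K}
    (h : (WeierstrassCurve.Affine.baseChange (curve A B) K).Nonsingular x y)
    (h3P : 3 • (Point.some x y h : Points K A B) ≠ 0) : psiNum (algebraMap F K A) x y ≠ 0 := by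
  rcases eq_or_ne y 0 with rfl | hy
  -- At y = 0, ψ₃ is -f'(x)², which is nonzero by nonsingularity.
  · have := curve_nonsingular_deriv h
    simpa [psiNum] using this
  · intro hψ
    obtain ⟨h', e⟩ := some_add_self h2 h hy
    rw [show (3 : ℕ) = 2 + 1 from rfl, succ_nsmul, two_nsmul] at h3P
    have hx : x - psiNum (algebraMap F K A) x y / (4 * y ^ 2) = x := by
      rw [hψ, zero_div, sub_zero]
    -- Equal abscissas mean 2P = P or 2P = -P, that is, P = 0 or 3P = 0.
    rcases Y_eq_of_X_eq h'.1 h.1 hx with hy' | hy'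
    · have : (Point.some x y h + Point.some x y h : Points K A B) = .some x y h := by
        rw [e, Point.some.injEq]
        exact ⟨hx, hy'⟩
      exact Point.some_ne_zero _ (add_eq_left.mp this)
    · rw [e] at h3P
      exact h3P (Point.add_of_Y_eq hx hy')

/-- The coordinates of `3P`. -/
lemma three_nsmul_some (h2 : (2 : K) ≠ 0) {x y : K}
    (h : (WeierstrassCurve.Affine.baseChange (curve A B) K).Nonsingular x y) (hy : y ≠ 0)
    (hψ : psiNum (algebraMap F K A) x y ≠ 0) :
    ∃ h', 3 • (Point.some x y h : Points K A B) =
      .some (tripleX (algebraMap F K A) x y) (tripleY (algebraMap F K A) x y) h' := by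
  have h4 : (4 : K) ≠ 0 := by
    have : (4 : K) = 2 ^ 2 := by norm_num
    rw [this]
    exact pow_ne_zero 2 h2
  have h8 : (8 : K) ≠ 0 := by
    have : (8 : K) = 2 ^ 3 := by norm_num
    rw [this]
    exact pow_ne_zero 3 h2
  obtain ⟨h', e⟩ := some_add_self h2 h hy
  rw [show (3 : ℕ) = 2 + 1 from rfl, succ_nsmul, two_nsmul, e]
  have hx : x - psiNum (algebraMap F K A) x y / (4 * y ^ 2) ≠ x := by
    intro e
    rw [sub_eq_self, div_eq_zero_iff] at e
    exact e.elim hψ (mul_ne_zero h4 (pow_ne_zero 2 hy))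
  have hm : slopeNum (algebraMap F K A) x y =
      (3 * x ^ 2 + algebraMap F K A) * psiNum (algebraMap F K A) x y - 16 * y ^ 4 := rfl
  have hψ' : psiNum (algebraMap F K A) x y =
      12 * x * y ^ 2 - (3 * x ^ 2 + algebraMap F K A) ^ 2 := rfl
  set m := slopeNum (algebraMap F K A) x y
  set ψ := psiNum (algebraMap F K A) x y
  have hslope : (WeierstrassCurve.Affine.baseChange (curve A B) K).slope (x - ψ / (4 * y ^ 2)) x
      ((m + 8 * y ^ 4) / (8 * y ^ 3)) y = -m / (2 * y * ψ) := by
    rw [slope_of_X_ne hx, sub_sub_cancel_left]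
    field_simp
    ring
  have hX : (WeierstrassCurve.Affine.baseChange (curve A B) K).addX (x - ψ / (4 * y ^ 2)) x
      (-m / (2 * y * ψ)) = tripleX (algebraMap F K A) x y := by
    rw [curve_addX, tripleX]
    change _ = x - 8 * y ^ 2 * (m + 8 * y ^ 4) / ψ ^ 2
    have key : m ^ 2 - 12 * x * y ^ 2 * ψ ^ 2 + ψ ^ 3 = -32 * y ^ 4 * (m + 8 * y ^ 4) := by
      rw [hm]
      linear_combination ψ ^ 2 * hψ'
    field_simp
    linear_combination 4 * key
  have hY : (WeierstrassCurve.Affine.baseChange (curve A B) K).addY (x - ψ / (4 * y ^ 2)) x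
      ((m + 8 * y ^ 4) / (8 * y ^ 3)) (-m / (2 * y * ψ)) = tripleY (algebraMap F K A) x y := by
    rw [addY, curve_negY, negAddY, hX, tripleX, tripleY]
    change -(_ * (x - 8 * y ^ 2 * (m + 8 * y ^ 4) / ψ ^ 2 - _) + _) =
      -(y + 4 * y * m * (m + 8 * y ^ 4) / ψ ^ 3)
    field_simp
    ring
  rw [Point.add_of_X_ne hx]
  have : ∀ {a b a' b' : K}
      (h₁ : (WeierstrassCurve.Affine.baseChange (curve A B) K).Nonsingular a b), a = a' → b = b' →
      ∃ h', (Point.some a b h₁ : Points K A B) = .some a' b' h' := by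
    rintro a b _ _ h₁ rfl rfl
    exact ⟨h₁, rfl⟩
  exact this _ (by rw [hslope, hX]) (by rw [hslope, hY])

end Triple

/-! ## The line through the conjugates of `3P` -/

section TripleLine

open WeierstrassCurve.Affine

variable {F K : Type*} [Field F] [Fintype F] [Field K] [Algebra F K] [DecidableEq K] {A B : F}

lemma natCast_ne_zero_of_ringChar_ne {R : Type*} [CommRing R] [Nontrivial R] {p : ℕ}
    (hp : p.Prime) (h : ringChar R ≠ p) : (p : R) ≠ 0 := by
  intro h0
  rcases (Nat.dvd_prime hp).mp ((ringChar.spec R p).mp h0) with h1 | h1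
  · exact CharP.ringChar_ne_one h1
  · exact h h1

lemma psiNum_conj_ne_zero (h2 : (2 : K) ≠ 0) {P : Points K A B} {x y : Fin 3 → K}
    {h : ∀ i, (WeierstrassCurve.Affine.baseChange (curve A B) K).Nonsingular (x i) (y i)}
    (hP : ∀ i : Fin 3, (frob K A B)^[(i : ℕ)] P = .some (x i) (y i) (h i)) (h3P : 3 • P ≠ 0)
    (i : Fin 3) : psiNum (algebraMap F K A) (x i) (y i) ≠ 0 := by
  refine psiNum_ne_zero h2 (h i) ?_
  rw [← hP i, ← iterate_map_nsmul, ← iterate_map_zero (frob K A B) i]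
  exact fun e ↦ h3P ((frob_injective.iterate i) e)

/-- 3d is the product of ψ₃ over the conjugates, and none of them is killed by 3 because Frobenius
is an injective homomorphism. -/
lemma d_ne_zero (h2 : (2 : K) ≠ 0) (h3 : (3 : F) ≠ 0) {P : Points K A B} {α₁ α₀ : F}
    (hα : IsConjLine P α₁ α₀) (h3P : 3 • P ≠ 0) : d A B α₁ α₀ ≠ 0 := by
  obtain ⟨x, y, h, hP, hy, hp⟩ := hα
  rw [map_cubic_sub] at hp
  obtain ⟨h₁, h₂, h₃⟩ := esymm_of_cubic_sub_eq_prod hp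
  have hψ := psiNum_conj_ne_zero h2 hP h3P
  intro hd
  have e := three_mul_d h3 A B α₁ α₀
  rw [hd, mul_zero] at e
  have e' := prod_psiNum h₁ h₂ h₃
  rw [← (map_tripling_polys (algebraMap F K) A B α₁ α₀).1, ← e, map_zero, ← hy, ← hy, ← hy] at e'
  exact mul_ne_zero (mul_ne_zero (hψ 0) (hψ 1)) (hψ 2) e'

lemma y_conj_ne_zero (hK : Module.finrank F K = 3) {P : Points K A B} {x y : Fin 3 → K}
    {h : ∀ i, (WeierstrassCurve.Affine.baseChange (curve A B) K).Nonsingular (x i) (y i)}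
    (hP : ∀ i : Fin 3, (frob K A B)^[(i : ℕ)] P = .some (x i) (y i) (h i)) (h0 : y 0 ≠ 0)
    (i : Fin 3) : y i ≠ 0 := by
  have hφ := frobenius_conj_coords hK hP
  have step : ∀ j, y j ≠ 0 → y (j + 1) ≠ 0 := fun j hj ↦ by
    rw [← (hφ j).2]
    exact (map_ne_zero_iff _ (FiniteField.frobeniusAlgHom F K).injective).mpr hj
  fin_cases i
  exacts [h0, step 0 h0, step 1 (step 0 h0)]

lemma y_conj_eq_zero (hK : Module.finrank F K = 3) {P : Points K A B} {x y : Fin 3 → K}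
    {h : ∀ i, (WeierstrassCurve.Affine.baseChange (curve A B) K).Nonsingular (x i) (y i)}
    (hP : ∀ i : Fin 3, (frob K A B)^[(i : ℕ)] P = .some (x i) (y i) (h i)) (h0 : y 0 = 0)
    (i : Fin 3) : y i = 0 := by
  have hφ := frobenius_conj_coords hK hP
  have step : ∀ j, y j = 0 → y (j + 1) = 0 := fun j hj ↦ by rw [← (hφ j).2, hj, map_zero]
  fin_cases i
  exacts [h0, step 0 h0, step 1 (step 0 h0)]

/-- -c is 8 times the product of the ordinates. One of them vanishes only if all do, and then P is
killed by 2. -/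
lemma c_ne_zero (hK : Module.finrank F K = 3) (h2 : (2 : K) ≠ 0) {P : Points K A B} {α₁ α₀ : F}
    (hα : IsConjLine P α₁ α₀) (h2P : 2 • P ≠ 0) : c A B α₁ α₀ ≠ 0 := by
  obtain ⟨x, y, h, hP, hy, hp⟩ := hα
  rw [map_cubic_sub] at hp
  obtain ⟨h₁, h₂, h₃⟩ := esymm_of_cubic_sub_eq_prod hp
  have hy0 : y 0 ≠ 0 := by
    intro e
    apply h2P
    have hP0 : P = .some (x 0) (y 0) (h 0) := hP 0
    rw [hP0]
    exact two_nsmul_some_of_y_eq_zero _ e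
  have hy' := y_conj_ne_zero hK hP hy0
  intro hc
  have e := eight_mul_prod_y h₁ h₂ h₃
  rw [← (map_tripling_polys (algebraMap F K) A B α₁ α₀).2.2.2.1, ← c_eq_dblC, hc, map_zero,
    neg_zero, ← hy, ← hy, ← hy, show (8 : K) = 2 ^ 3 by norm_num] at e
  exact mul_ne_zero (pow_ne_zero 3 h2) (mul_ne_zero (mul_ne_zero (hy' 0) (hy' 1)) (hy' 2)) e

lemma linePoly_scale {k : Type*} [Field k] {t γ β₁ β₀ : k} (hγ : γ ≠ 0) :
    C (C t) * linePoly γ β₁ β₀ = C (C (t * γ)) * linePoly 1 (β₁ / γ) (β₀ / γ) := by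
  have hC : ∀ a : k, (C (C a) : k[X][Y]) = C (C γ) * C (C (a / γ)) := fun a ↦ by
    rw [← C_mul, ← C_mul, mul_div_cancel₀ _ hγ]
  simp only [linePoly, C_mul, C_add]
  rw [hC β₁, hC β₀, C_1, C_1]
  ring

/-- The tripling formulas give the line through the conjugates of `3P`. -/
lemma isConjLine_three_nsmul (hK : Module.finrank F K = 3) (h2 : (2 : K) ≠ 0) (h3 : (3 : F) ≠ 0)
    {P : Points K A B} {α₁ α₀ : F} (hα : IsConjLine P α₁ α₀) (h3P : 3 • P ≠ 0) :
    IsConjLine (3 • P) (v₁ A B α₁ α₀ / d A B α₁ α₀) (v₀ A B α₁ α₀ / d A B α₁ α₀) := by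
  have hd := d_ne_zero h2 h3 hα h3P
  have hα' := hα
  obtain ⟨x, y, h, hP, hy, hp⟩ := hα
  rw [map_cubic_sub] at hp
  have hψ := psiNum_conj_ne_zero h2 hP h3P
  -- If y = 0 the affine doubling formula breaks down, but then 3P = P, the line is y = 0, and `v₁`,
  -- `v₀` vanish at α₁ = α₀ = 0.
  by_cases hy0 : y 0 = 0
  · have hy' := y_conj_eq_zero hK hP hy0
    obtain ⟨e₁, e₀⟩ := line_eq_zero h hy hy' hp
    rw [map_eq_zero] at e₁ e₀
    subst e₁ e₀
    have h2P : 2 • P = 0 := by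
      have hP0 : P = .some (x 0) (y 0) (h 0) := hP 0
      rw [hP0]
      exact two_nsmul_some_of_y_eq_zero _ hy0
    rw [show 3 • P = P by rw [show (3 : ℕ) = 2 + 1 from rfl, succ_nsmul, h2P, zero_add]]
    simpa [v₁, v₀] using hα'
  · have hy' := y_conj_ne_zero hK hP hy0
    have h3x := fun i ↦ three_nsmul_some h2 (h i) (hy' i) (hψ i)
    choose h' hh using h3x
    have h3K : algebraMap F K 3 ≠ 0 := (_root_.map_ne_zero _).mpr h3
    have hdiv : ∀ {a b : F}, algebraMap F K (a / b) = algebraMap F K (3 * a) /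
        algebraMap F K (3 * b) := fun {a b} ↦ by
      rw [map_div₀, map_mul, map_mul, mul_div_mul_left _ _ h3K]
    obtain ⟨eD, e₁, e₀, -⟩ := map_tripling_polys (algebraMap F K) A B α₁ α₀
    have hD : tripD (algebraMap F K A) (algebraMap F K B) (algebraMap F K α₁)
        (algebraMap F K α₀) ≠ 0 := by
      rw [← eD, ← three_mul_d h3, map_mul]
      exact mul_ne_zero h3K ((_root_.map_ne_zero _).mpr hd)
    rw [isConjLine_iff (h := h') fun i ↦ by rw [iterate_map_nsmul, hP i, hh i]]
    rw [hdiv, hdiv, three_mul_d h3, three_mul_v₁ h3, three_mul_v₀ h3, eD, e₁, e₀]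
    -- The cubic identity sees the line only through its square; the incidence from `tripD_mul_y`
    -- fixes the sign of the ordinates.
    refine ⟨fun i ↦ ?_, cubic_sub_tripling_line hp hy hψ⟩
    have e := tripD_mul_y (hy i) ((curve_equation_iff _ _).mp (h i).1) (hψ i)
    rw [← tripleX, ← tripleY] at e
    field_simp
    linear_combination e

end TripleLine

end TraceZero

end

theorem mainTheorem7 {F : Type u} [Field F] [Fintype F]
    (hF2 : ringChar F ≠ 2) (hF3 : ringChar F ≠ 3)
    {K : Type v} [Field K] [DecidableEq K] [Algebra F K] (hK : Module.finrank F K = 3)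
    (A B : F) (hE : (TraceZero.cubic A B).Separable) :
    -- The procedure, run on `y - (α₁ x + α₀)` with `α₁, α₀` in an extension field of `F`, in
    -- particular with indeterminates `α₁, α₀`, yields the tripling formulas.
    (∀ (k : Type u) [Field k] [Algebra F k] (α₁ α₀ : k),
      TraceZero.c (algebraMap F k A) (algebraMap F k B) α₁ α₀ ≠ 0 →
        (∃! L : k[X][Y], TraceZero.IsProcL (algebraMap F k A) (algebraMap F k B) α₁ α₀ L) ∧
        ∀ L : k[X][Y], TraceZero.IsProcL (algebraMap F k A) (algebraMap F k B) α₁ α₀ L →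
          ∃ t : k, t ≠ 0 ∧
            TraceZero.recovered (algebraMap F k A) (algebraMap F k B) α₁ α₀ L =
              TraceZero.toFun (algebraMap F k A) (algebraMap F k B)
                (C (C t) * TraceZero.linePoly
                  (TraceZero.d (algebraMap F k A) (algebraMap F k B) α₁ α₀)
                  (TraceZero.v₁ (algebraMap F k A) (algebraMap F k B) α₁ α₀)
                  (TraceZero.v₀ (algebraMap F k A) (algebraMap F k B) α₁ α₀))) ∧
    ∀ P ∈ TraceZero.T₃ K A B, P ≠ 0 →
      -- The line `h_P` exists and is unique.
      (∃! α : F × F, TraceZero.IsConjLine P α.1 α.2) ∧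
      ∀ α₁ α₀ : F, TraceZero.IsConjLine P α₁ α₀ → 3 • P ≠ 0 →
        -- The tripling formulas give `h_{3P}`, up to a nonzero constant.
        (TraceZero.d A B α₁ α₀ ≠ 0 ∧
          TraceZero.IsConjLine (3 • P)
            (TraceZero.v₁ A B α₁ α₀ / TraceZero.d A B α₁ α₀)
            (TraceZero.v₀ A B α₁ α₀ / TraceZero.d A B α₁ α₀)) ∧
        -- The procedure, run on `h_P`, is well defined and recovers `h_{3P}`, up to a nonzero
        -- constant.
        (2 • P ≠ 0 →
          TraceZero.c A B α₁ α₀ ≠ 0 ∧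
          (∃! L : F[X][Y], TraceZero.IsProcL A B α₁ α₀ L) ∧
          ∀ L : F[X][Y], TraceZero.IsProcL A B α₁ α₀ L →
            ∀ γ₁ γ₀ : F, TraceZero.IsConjLine (3 • P) γ₁ γ₀ →
              ∃ t : F, t ≠ 0 ∧
                TraceZero.recovered A B α₁ α₀ L =
                  TraceZero.toFun A B (C (C t) * TraceZero.linePoly 1 γ₁ γ₀)) := by
  have h2 : (2 : F) ≠ 0 := by
    exact_mod_cast TraceZero.natCast_ne_zero_of_ringChar_ne Nat.prime_two hF2
  have h3 : (3 : F) ≠ 0 := by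
    exact_mod_cast TraceZero.natCast_ne_zero_of_ringChar_ne Nat.prime_three hF3
  have h2K : (2 : K) ≠ 0 := by
    rw [← map_ofNat (algebraMap F K) 2]
    exact (_root_.map_ne_zero _).mpr h2
  refine ⟨fun k _ _ α₁ α₀ hc ↦ ?_, fun P hT hP ↦
    ⟨TraceZero.existsUnique_isConjLine hK h2K hT hP, fun α₁ α₀ hα h3P ↦ ?_⟩⟩
  · refine TraceZero.procedure_correct ?_ hc
    rw [← map_ofNat (algebraMap F k) 3]
    exact (_root_.map_ne_zero _).mpr h3
  · have hd := TraceZero.d_ne_zero h2K h3 hα h3P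
    have hγ := TraceZero.isConjLine_three_nsmul hK h2K h3 hα h3P
    refine ⟨⟨hd, hγ⟩, fun h2P ↦ ?_⟩
    have hc := TraceZero.c_ne_zero hK h2K hα h2P
    obtain ⟨hL, hrec⟩ := TraceZero.procedure_correct h3 hc
    refine ⟨hc, hL, fun L hL γ₁ γ₀ hγ' ↦ ?_⟩
    obtain ⟨t, ht, e⟩ := hrec L hL
    obtain ⟨rfl, rfl⟩ := hγ'.unique h2K hγ
    -- The factor `d` appears on normalising d y - (v₁x + v₀) to leading coefficient 1 in y.
    refine ⟨t * TraceZero.d A B α₁ α₀, mul_ne_zero ht hd, ?_⟩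
    rw [e, TraceZero.linePoly_scale hd]
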